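/- **Setting.** Let $p\ge 1$ and let $\mathsf T=(\mathcal V,\mathcal E_{\mathsf T})$ be a tree on $p$ nodes. Let $\beta\ge 0$ and let $P$ be a zero-field Ising model on $\mathsf T$, $P(x)\propto\exp\big(\sum_{(i,j)\in\mathcal E_{\mathsf T}}\theta_{ij}x_ix_j\big)$ for $x\in\{-1,+1\}^{\mathcal V}$, with $|\theta_{ij}|\le\beta$ for all $(i,j)\in\mathcal E_{\mathsf T}$. Write $\mu_{ij}=\mathbb E_P[X_iX_j]$. Let $X^{(1)},\dots,X^{(n)}$ be i.i.d. samples from $P$, let $\widehat P$ be their empirical distribution and $\widehat\mu_{ij}=\mathbb E_{\widehat P}[X_iX_j]$. For $\delta\in(0,1)$ put $$\epsilon=\sqrt{\tfrac2n\log\tfrac{2p^2}{\delta}},\qquad \tau=\frac{4\epsilon}{\sqrt{1-\tanh\beta}} .$$ **Truncation algorithm.** Take a spanning tree $\mathsf T^{\mathrm{CL}}$ of the complete graph on $\mathcal V$ that maximizes $\sum_{e}|\widehat\mu_e|$ (ties broken arbitrarily) and delete from it all edges $e$ with $|\widehat\mu_e|<\tau+\epsilon$. The result is the output $\widehat{\mathsf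 T}$. **Projection.** For a forest $\mathsf F$ and a distribution $Q$ on $\{-1,+1\}^{\mathcal V}$, let $\Pi_{\mathsf F}(Q)$ be the minimizer of $D(Q\|R)$ over all zero-field Ising models $R$ on $\mathsf F$, with parameters in $[-\infty,\infty]$ (that is, over pointwise limits of Ising models on $\mathsf F$ with real parameters). **Loss.** $\mathcal L^{(2)}(P,Q)=\sup_{|S|=2} d_{\mathrm{TV}}(P_S,Q_S)$, where $P_S$ is the marginal of $P$ on $S\subseteq\mathcal V$ (and the supremum is $0$ if $p=1$). **Proposition.** There is a universal constant $C>0$ such that for all $p,n,\mathsf T,\beta,P$ as above, all $\eta>0$ and all $\delta\in(0,1)$, if $$ n> C\max\Big\{\frac{e^{2\beta}}{\eta^{2}}\log\frac p\delta,\ \frac1{\eta^{2}}\log\frac{p}{\eta\delta}\Big\},$$ then with probability at least $1-\delta$ the truncation algorithm has an output, and every output $\widehat{\mathsf T}$ of it (whatever the tie-breaking) has the following properties: $\widehat{\mathsf T}$ is a forest; $\mathcal E_{\widehat{\mathsf T}}\subseteq\mathcal E_{\mathsf T}$; every edge $e\in\mathcal E_{\mathsf T}$ with $|\mu_e|\ge\tau+2\epsilon$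 belongs to $\mathcal E_{\widehat{\mathsf T}}$; the projection $\Pi_{\widehat{\mathsf T}}(\widehat P)$ exists, is unique and matches the empirical correlations $\widehat\mu_e$ on all $e\in\mathcal E_{\widehat{\mathsf T}}$; and $$\mathcal L^{(2)}\big(P,\Pi_{\widehat{\mathsf T}}(\widehat P)\big)<\eta .$$ -/

import Mathlib

open MeasureTheory Filter Topology
open scoped ENNReal

/-- Spin configurations on a vertex set `V`; `true` stands for the spin `+1`, `false` for `-1`. -/
abbrev SpinConfig (V : Type*) : Type _ := V → Bool

/-- The numerical value of a spin. -/
def spinVal (b : Bool) : ℝ := if b then 1 else -1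

/-- The product `x i * x j` of the two spins at the ends of the pair `e = s(i, j)`. -/
def edgeSpin {V : Type*} (x : SpinConfig V) : Sym2 V → ℝ :=
  Sym2.lift ⟨fun i j => spinVal (x i) * spinVal (x j), fun _ _ => mul_comm _ _⟩

section Ising

variable {V : Type*} [Fintype V] [DecidableEq V]

open Classical in
/-- The sum of the weights of the edges of a graph. -/
noncomputable def edgeWeight (w : Sym2 V → ℝ) (G : SimpleGraph V) : ℝ :=
  ∑ e ∈ G.edgeFinset, w e

/-- The normalizing constant of the zero-field Ising model on `G` with edge parameters `θ`. -/
noncomputable def isingPartition (G : SimpleGraph V) (θ : Sym2 V → ℝ) : ℝ :=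
  ∑ x : SpinConfig V, Real.exp (edgeWeight (fun e => θ e * edgeSpin x e) G)

/-- The Ising model on `G` without external field: the configuration `x` has probability
proportional to the exponential of the sum of `θ (i, j) * x i * x j` over the edges. -/
noncomputable def isingMeasure (G : SimpleGraph V) (θ : Sym2 V → ℝ) : Measure (SpinConfig V) :=
  ∑ x : SpinConfig V,
    ENNReal.ofReal
      (Real.exp (edgeWeight (fun e => θ e * edgeSpin x e) G) / isingPartition G θ) •
        Measure.dirac x

/-- The correlation of the spins at the two ends of the pair `e`. -/
noncomputable def corr (Q : Measure (SpinConfig V)) (e : Sym2 V) : ℝ :=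
  ∫ x, edgeSpin x e ∂Q

/-- The empirical distribution of `n` samples. -/
noncomputable def empiricalDist {n : ℕ} (X : Fin n → SpinConfig V) : Measure (SpinConfig V) :=
  (n : ℝ≥0∞)⁻¹ • ∑ l : Fin n, Measure.dirac (X l)

/-- The zero-field Ising models on `G` with unrestricted parameters, infinite parameters being
allowed: probability measures that are pointwise limits of Ising models on `G` with real
parameters. -/
def IsExtendedIsing (G : SimpleGraph V) (Q : Measure (SpinConfig V)) : Prop :=
  IsProbabilityMeasure Q ∧ ∃ θ : ℕ → Sym2 V → ℝ, ∀ x : SpinConfig V,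
    Tendsto (fun k => (isingMeasure G (θ k)).real {x}) atTop (𝓝 (Q.real {x}))

/-- `R` minimizes the divergence `D(P ‖ Q)` over the zero-field Ising models `Q` on `G`. -/
def IsIsingProjection (G : SimpleGraph V) (P R : Measure (SpinConfig V)) : Prop :=
  IsExtendedIsing G R ∧ ∀ Q : Measure (SpinConfig V), IsExtendedIsing G Q →
    InformationTheory.klDiv P R ≤ InformationTheory.klDiv P Q

/-- `S` is a spanning tree of the complete graph of maximum total weight. -/
def IsMaxSpanningTree (w : Sym2 V → ℝ) (S : SimpleGraph V) : Prop :=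
  S.IsTree ∧ ∀ S' : SimpleGraph V, S'.IsTree → edgeWeight w S' ≤ edgeWeight w S

/-- `F` is a possible output of the truncation algorithm on the samples `X` at level `s`:
a spanning tree that is maximal for the absolute empirical correlations (ties broken arbitrarily),
from which the edges with absolute empirical correlation less than `s` are removed. -/
def IsTruncationOutput {n : ℕ} (X : Fin n → SpinConfig V) (s : ℝ) (F : SimpleGraph V) : Prop :=
  ∃ S : SimpleGraph V, IsMaxSpanningTree (fun e => |corr (empiricalDist X) e|) S ∧
    F = SimpleGraph.fromEdgeSet {e | e ∈ S.edgeSet ∧ s ≤ |corr (empiricalDist X) e|}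

end Ising

/-- Total variation distance of two probability measures on a finite set. -/
noncomputable def tvDist {α : Type*} [Fintype α] [MeasurableSpace α] (μ ν : Measure α) : ℝ :=
  1 / 2 * ∑ a : α, |μ.real {a} - ν.real {a}|

/-- The small-set total variation: the largest total variation distance of the marginals of `P`
and `Q` on `k` vertices. -/
noncomputable def smallSetTV {V : Type*} [Fintype V] [DecidableEq V] (k : ℕ)
    (P Q : Measure (SpinConfig V)) : ℝ :=
  ⨆ S : {S : Finset V // S.card = k},
    tvDist (P.map (fun x (i : S.1) => x i)) (Q.map (fun x (i : S.1) => x i))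

/-- The deviation level `ε = √((2 / n) log (2 p² / δ))`. -/
noncomputable def devLevel (n p : ℕ) (δ : ℝ) : ℝ :=
  √(2 / n * Real.log (2 * (p : ℝ) ^ 2 / δ))

/-- The threshold `τ = 4 ε / √(1 - tanh β)`. -/
noncomputable def truncThreshold (n p : ℕ) (β δ : ℝ) : ℝ :=
  4 * devLevel n p δ / √(1 - Real.tanh β)

/-! ### Spin products, cuts and flips -/

section Spins

variable {V : Type*}

/-! For a sign `s`, `exp (θ s) = cosh θ * (1 + tanh θ * s)`, so an Ising model on a forest has
density `2 ^ (-|V|) ∏ (1 + m e * x e)` with `m e = tanh (θ e)`. Flipping all spins on one side of a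
forest edge reverses the spin product of that edge and of no other forest edge. Hence the edge
products are independent signs of means `m e`, and the correlation of two vertices is the product of
`m` along the path joining them, or `0` if there is none (`sum_prod_one_add_mul_prod`).

In these coordinates the divergence from `Q` splits over the edges, so the projection is the forest
density with the edge correlations of `Q` (`isIsingProjection_densityMeasure`). Single spins are
unbiased, so the total variation on a pair is half the difference of the correlations
(`tvDist_restrict_pair`).

Three events fail with total probability at most `δ`. (1) All empirical correlations are
`ε`-accurate, by Hoeffding. (2) A tree edge `f` with `|m f| ≥ τ` strictly beats every other pair
joined through it: the two spin products differ only when the remaining path product `A` is `-1`,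
and Chernoff's exponent is proportional to `(1 - |E A|) * m f ^ 2 ≥ (1 - tanh β) * τ ^ 2`, which
dictates `τ` (`pi_real_abs_corr_le_abs_corr`). (3) Along every path the product of the empirical
edge correlations is `η`-close to the true product, at a rate free of the path length
(`sum_pi_exp_prod_sub_prod_le`).

The rest is deterministic. By exchange, a maximum spanning tree `S` contains all strong edges. An
edge surviving truncation has true correlation at least `τ` in absolute value; this is a product
over its tree path, so all path edges are strong and lie in `S`, and acyclicity of `S` makes the
surviving edge one of them. For the loss, a pair connected in the output is covered by (3). For any
other pair the projection has correlation `0`, and its tree path contains a deleted edge, with `|m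
e| < τ + 2ε < 2η`. -/

theorem spinVal_mul_self (b : Bool) : spinVal b * spinVal b = 1 := by
  cases b <;> simp [spinVal]

theorem spinVal_not (b : Bool) : spinVal (!b) = -spinVal b := by
  cases b <;> simp [spinVal]

@[simp]
theorem edgeSpin_mk (x : SpinConfig V) (a b : V) :
    edgeSpin x s(a, b) = spinVal (x a) * spinVal (x b) := rfl

theorem edgeSpin_mul_self (x : SpinConfig V) (e : Sym2 V) : edgeSpin x e * edgeSpin x e = 1 := by
  induction e with
  | h a b =>
    rw [edgeSpin_mk, mul_mul_mul_comm, spinVal_mul_self, spinVal_mul_self, one_mul]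

theorem edgeSpin_eq_or (x : SpinConfig V) (e : Sym2 V) : edgeSpin x e = 1 ∨ edgeSpin x e = -1 :=
  mul_self_eq_one_iff.mp (edgeSpin_mul_self x e)

theorem abs_edgeSpin (x : SpinConfig V) (e : Sym2 V) : |edgeSpin x e| = 1 := by
  rcases edgeSpin_eq_or x e with h | h <;> simp [h]

theorem one_add_mul_edgeSpin_nonneg {m : ℝ} (hm : |m| ≤ 1) (x : SpinConfig V) (e : Sym2 V) :
    0 ≤ 1 + m * edgeSpin x e := by
  obtain ⟨h1, h2⟩ := abs_le.mp hm
  rcases edgeSpin_eq_or x e with h | h <;> rw [h] <;> linarith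

open Classical in
/-- The involution of the configurations that flips all spins in `A`. -/
noncomputable def flipOn (A : Set V) : SpinConfig V ≃ SpinConfig V :=
  Function.Involutive.toPerm (fun x v => if v ∈ A then !x v else x v) fun x => by
    funext v
    by_cases h : v ∈ A <;> simp [h]

theorem flipOn_of_mem {A : Set V} {v : V} (h : v ∈ A) (x : SpinConfig V) :
    flipOn A x v = !x v :=
  if_pos h

theorem flipOn_of_notMem {A : Set V} {v : V} (h : v ∉ A) (x : SpinConfig V) :
    flipOn A x v = x v :=
  if_neg h

theorem edgeSpin_flipOn_of_iff {A : Set V} {a b : V} (h : a ∈ A ↔ b ∈ A) (x : SpinConfig V) :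
    edgeSpin (flipOn A x) s(a, b) = edgeSpin x s(a, b) := by
  by_cases ha : a ∈ A
  · rw [edgeSpin_mk, edgeSpin_mk, flipOn_of_mem ha, flipOn_of_mem (h.mp ha), spinVal_not,
      spinVal_not, neg_mul_neg]
  · rw [edgeSpin_mk, edgeSpin_mk, flipOn_of_notMem ha, flipOn_of_notMem (mt h.mpr ha)]

theorem edgeSpin_flipOn_of_not_iff {A : Set V} {a b : V} (h : ¬(a ∈ A ↔ b ∈ A))
    (x : SpinConfig V) : edgeSpin (flipOn A x) s(a, b) = -edgeSpin x s(a, b) := by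
  by_cases ha : a ∈ A
  · have hb : b ∉ A := fun hb => h ⟨fun _ => hb, fun _ => ha⟩
    rw [edgeSpin_mk, edgeSpin_mk, flipOn_of_mem ha, flipOn_of_notMem hb, spinVal_not, neg_mul]
  · have hb : b ∈ A := by tauto
    rw [edgeSpin_mk, edgeSpin_mk, flipOn_of_notMem ha, flipOn_of_mem hb, spinVal_not, mul_neg]

/-- The edge `e` is the only edge of `G` between `A` and its complement. -/
def IsCut (G : SimpleGraph V) (e : Sym2 V) (A : Set V) : Prop :=
  (∀ a b, s(a, b) = e → ¬(a ∈ A ↔ b ∈ A)) ∧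
    ∀ a b, G.Adj a b → s(a, b) ≠ e → (a ∈ A ↔ b ∈ A)

/-- Every edge of a forest is a bridge; the side is the component of one endpoint once the edge is
deleted. -/
theorem SimpleGraph.IsAcyclic.exists_isCut {G : SimpleGraph V} (hG : G.IsAcyclic) {e : Sym2 V}
    (he : e ∈ G.edgeSet) : ∃ A : Set V, IsCut G e A := by
  have hb := SimpleGraph.isAcyclic_iff_forall_isBridge.mp hG he
  induction e with
  | h u v =>
    rw [SimpleGraph.isBridge_iff] at hb
    refine ⟨{w | (G.deleteEdges {s(u, v)}).Reachable u w}, fun a b hab => ?_, fun a b hab hne => ?_⟩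
    · rcases Sym2.eq_iff.mp hab with ⟨rfl, rfl⟩ | ⟨rfl, rfl⟩
      · simpa using hb
      · simpa using hb
    · have : (G.deleteEdges {s(u, v)}).Adj a b := by
        simpa [SimpleGraph.deleteEdges_adj, hab] using hne
      exact ⟨fun h => h.trans this.reachable, fun h => h.trans this.symm.reachable⟩

theorem IsCut.edgeSpin_flipOn_self {G : SimpleGraph V} {e : Sym2 V} {A : Set V}
    (h : IsCut G e A) (x : SpinConfig V) : edgeSpin (flipOn A x) e = -edgeSpin x e := by
  induction e with
  | h a b => exact edgeSpin_flipOn_of_not_iff (h.1 a b rfl) x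

theorem IsCut.edgeSpin_flipOn_of_ne {G : SimpleGraph V} {e e' : Sym2 V} {A : Set V}
    (h : IsCut G e A) (he' : e' ∈ G.edgeSet) (hne : e' ≠ e) (x : SpinConfig V) :
    edgeSpin (flipOn A x) e' = edgeSpin x e' := by
  induction e' with
  | h a b => exact edgeSpin_flipOn_of_iff (h.2 a b he' hne) x

theorem IsCut.mem_edges {G : SimpleGraph V} {e : Sym2 V} {A : Set V} {a b : V}
    (h : IsCut G e A) (p : G.Walk a b)
    (hab : ¬(a ∈ A ↔ b ∈ A)) : e ∈ p.edges := by
  induction p with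
  | nil => exact absurd Iff.rfl hab
  | @cons u v w huv p ih =>
    rw [SimpleGraph.Walk.edges_cons, List.mem_cons]
    by_cases hne : s(u, v) = e
    · exact Or.inl hne.symm
    · exact Or.inr (ih fun hvw => hab ((h.2 u v huv hne).trans hvw))

theorem exists_crossing_mem_edges {G : SimpleGraph V} {A : Set V} {a b : V} (p : G.Walk a b)
    (hab : ¬(a ∈ A ↔ b ∈ A)) : ∃ c d, s(c, d) ∈ p.edges ∧ ¬(c ∈ A ↔ d ∈ A) := by
  induction p with
  | nil => exact absurd Iff.rfl hab
  | @cons u v w huv p ih =>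
    by_cases hne : (u ∈ A ↔ v ∈ A)
    · obtain ⟨c, d, hcd, h⟩ := ih fun hvw => hab (hne.trans hvw)
      exact ⟨c, d, List.mem_cons_of_mem _ hcd, h⟩
    · exact ⟨u, v, by simp, hne⟩

/-- Each interior vertex contributes its spin twice, so the product telescopes. -/
theorem prod_edgeSpin_edges {G : SimpleGraph V} {a b : V} (p : G.Walk a b) (x : SpinConfig V) :
    (p.edges.map (edgeSpin x)).prod = edgeSpin x s(a, b) := by
  induction p with
  | nil => simp [spinVal_mul_self]
  | @cons u v w huv p ih =>
    rw [SimpleGraph.Walk.edges_cons, List.map_cons, List.prod_cons, ih, edgeSpin_mk, edgeSpin_mk,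
      edgeSpin_mk, mul_assoc, ← mul_assoc (spinVal (x v)), spinVal_mul_self, one_mul]

theorem prod_edgeSpin_path [DecidableEq V] {G : SimpleGraph V} {a b : V} {p : G.Walk a b}
    (hp : p.IsPath) (x : SpinConfig V) :
    ∏ e ∈ p.edges.toFinset, edgeSpin x e = edgeSpin x s(a, b) := by
  rw [List.prod_toFinset _ hp.isTrail.edges_nodup, prod_edgeSpin_edges]

end Spins

/-! ### The product density of a forest Ising model -/

section Density

set_option linter.unusedSectionVars false
variable {V : Type*} [Fintype V] [DecidableEq V]

theorem sum_flipOn (A : Set V) (f : SpinConfig V → ℝ) : ∑ x, f (flipOn A x) = ∑ x, f x :=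
  Equiv.sum_comp (flipOn A) f

theorem sum_eq_zero_of_flipOn {A : Set V} {f : SpinConfig V → ℝ}
    (h : ∀ x, f (flipOn A x) = -f x) : ∑ x, f x = 0 := by
  have := sum_flipOn A f
  simp only [h, Finset.sum_neg_distrib] at this
  linarith

/-- Induction on `S`. The factor of a new edge `f` splits into a part even and a part odd in `x f`;
the flip across the cut of `f` fixes all other factors, so whatever is odd in `x f` sums to zero.
What survives has coefficient `1` if `f ∉ U`, and `m f` if `f ∈ U`, as `x f` squares to `1`. -/
theorem sum_prod_one_add_mul_prod {G : SimpleGraph V} (hG : G.IsAcyclic) (m : Sym2 V → ℝ)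
    (S : Finset (Sym2 V)) (hS : ∀ e ∈ S, e ∈ G.edgeSet) :
    ∀ U ⊆ S, ∑ x : SpinConfig V, (∏ e ∈ S, (1 + m e * edgeSpin x e)) * ∏ e ∈ U, edgeSpin x e
      = 2 ^ Fintype.card V * ∏ e ∈ U, m e := by
  induction S using Finset.induction_on with
  | empty =>
    intro U hU
    rw [Finset.subset_empty.mp hU]
    simp
  | insert f S hf ih =>
    intro U hU
    have hS' : ∀ e ∈ S, e ∈ G.edgeSet := fun e he => hS e (Finset.mem_insert_of_mem he)
    obtain ⟨A, hA⟩ := hG.exists_isCut (hS f (Finset.mem_insert_self _ _))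
    have hUS : U.erase f ⊆ S := by
      rw [← Finset.erase_insert hf]
      exact Finset.erase_subset_erase _ hU
    have hzero : ∑ x : SpinConfig V, ((∏ e ∈ S, (1 + m e * edgeSpin x e)) *
        ∏ e ∈ U.erase f, edgeSpin x e) * edgeSpin x f = 0 := by
      apply sum_eq_zero_of_flipOn (A := A)
      intro x
      have h : ∀ e ∈ S, edgeSpin (flipOn A x) e = edgeSpin x e := fun e he =>
        hA.edgeSpin_flipOn_of_ne (hS' e he) (fun h => hf (h ▸ he)) x
      rw [hA.edgeSpin_flipOn_self, mul_neg,
        Finset.prod_congr rfl fun e he => by rw [h e he],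
        Finset.prod_congr rfl fun e he => h e (hUS he)]
    have hmain := ih hS' _ hUS
    by_cases hfU : f ∈ U
    · rw [← Finset.mul_prod_erase U m hfU, mul_left_comm, ← hmain, Finset.mul_sum]
      rw [← zero_add (∑ x : SpinConfig V, m f * _), ← hzero, ← Finset.sum_add_distrib]
      refine Finset.sum_congr rfl fun x _ => ?_
      rw [Finset.prod_insert hf, ← Finset.mul_prod_erase U _ hfU]
      linear_combination (m f * (∏ e ∈ S, (1 + m e * edgeSpin x e)) *
        ∏ e ∈ U.erase f, edgeSpin x e) * edgeSpin_mul_self x f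
    · rw [Finset.erase_eq_of_notMem hfU] at hmain hzero
      rw [← hmain, ← add_zero (∑ x : SpinConfig V, (∏ e ∈ S, _) * _), ← mul_zero (m f), ← hzero,
        Finset.mul_sum, ← Finset.sum_add_distrib]
      refine Finset.sum_congr rfl fun x _ => ?_
      rw [Finset.prod_insert hf]
      ring

open Classical in
/-- The density `2 ^ (-|V|) ∏ (1 + m e * x e)` of the Ising model on a forest whose edge
correlations are `m`. -/
noncomputable def forestDensity (G : SimpleGraph V) (m : Sym2 V → ℝ) (x : SpinConfig V) : ℝ :=
  (2 ^ Fintype.card V)⁻¹ * ∏ e ∈ G.edgeFinset, (1 + m e * edgeSpin x e)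

theorem forestDensity_nonneg {G : SimpleGraph V} {m : Sym2 V → ℝ}
    (hm : ∀ e ∈ G.edgeSet, |m e| ≤ 1) (x : SpinConfig V) : 0 ≤ forestDensity G m x := by
  classical
  refine mul_nonneg (by positivity) (Finset.prod_nonneg fun e he => ?_)
  exact one_add_mul_edgeSpin_nonneg (hm e (SimpleGraph.mem_edgeFinset.mp he)) x e

theorem forestDensity_congr {G : SimpleGraph V} {m m' : Sym2 V → ℝ}
    (h : ∀ e ∈ G.edgeSet, m e = m' e) (x : SpinConfig V) :
    forestDensity G m x = forestDensity G m' x := by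
  classical
  unfold forestDensity
  congr 1
  refine Finset.prod_congr rfl fun e he => ?_
  rw [h e (SimpleGraph.mem_edgeFinset.mp he)]

theorem sum_forestDensity_mul_prod {G : SimpleGraph V} (hG : G.IsAcyclic) (m : Sym2 V → ℝ)
    {U : Finset (Sym2 V)} (hU : ∀ e ∈ U, e ∈ G.edgeSet) :
    ∑ x, forestDensity G m x * ∏ e ∈ U, edgeSpin x e = ∏ e ∈ U, m e := by
  classical
  unfold forestDensity
  simp_rw [mul_assoc]
  rw [← Finset.mul_sum, sum_prod_one_add_mul_prod hG m _
    (fun e he => SimpleGraph.mem_edgeFinset.mp he) U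
    (fun e he => SimpleGraph.mem_edgeFinset.mpr (hU e he))]
  rw [inv_mul_cancel_left₀ (by positivity)]

theorem sum_forestDensity {G : SimpleGraph V} (hG : G.IsAcyclic) (m : Sym2 V → ℝ) :
    ∑ x, forestDensity G m x = 1 := by
  simpa using sum_forestDensity_mul_prod hG m (U := ∅) (by simp)

theorem sum_forestDensity_mul_edgeSpin {G : SimpleGraph V} (hG : G.IsAcyclic) (m : Sym2 V → ℝ)
    {e : Sym2 V} (he : e ∈ G.edgeSet) : ∑ x, forestDensity G m x * edgeSpin x e = m e := by
  simpa using sum_forestDensity_mul_prod hG m (U := {e}) (by simpa using he)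

theorem sum_forestDensity_mul_edgeSpin_path {G : SimpleGraph V} (hG : G.IsAcyclic)
    (m : Sym2 V → ℝ) {a b : V} {p : G.Walk a b} (hp : p.IsPath) :
    ∑ x, forestDensity G m x * edgeSpin x s(a, b) = ∏ e ∈ p.edges.toFinset, m e := by
  rw [← sum_forestDensity_mul_prod hG m fun e he =>
    p.edges_subset_edgeSet (List.mem_toFinset.mp he)]
  simp_rw [prod_edgeSpin_path hp]

theorem forestDensity_flipOn {G : SimpleGraph V} {A : Set V}
    (hA : ∀ a b, G.Adj a b → (a ∈ A ↔ b ∈ A)) (m : Sym2 V → ℝ) (x : SpinConfig V) :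
    forestDensity G m (flipOn A x) = forestDensity G m x := by
  unfold forestDensity
  congr 1
  refine Finset.prod_congr rfl fun e he => ?_
  induction e with
  | h a b => rw [edgeSpin_flipOn_of_iff (hA a b (by simpa using he))]

theorem sum_forestDensity_mul_edgeSpin_of_not_reachable (G : SimpleGraph V)
    (m : Sym2 V → ℝ) {a b : V} (hab : ¬G.Reachable a b) :
    ∑ x, forestDensity G m x * edgeSpin x s(a, b) = 0 := by
  have hA : ∀ c d, G.Adj c d → (c ∈ {v | G.Reachable a v} ↔ d ∈ {v | G.Reachable a v}) :=
    fun c d h => ⟨fun h' => h'.trans h.reachable, fun h' => h'.trans h.symm.reachable⟩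
  refine sum_eq_zero_of_flipOn (A := {v | G.Reachable a v}) fun x => ?_
  rw [forestDensity_flipOn hA, edgeSpin_flipOn_of_not_iff (by simpa using hab), mul_neg]

theorem sum_forestDensity_mul_spinVal (G : SimpleGraph V) (m : Sym2 V → ℝ) (a : V) :
    ∑ x, forestDensity G m x * spinVal (x a) = 0 := by
  refine sum_eq_zero_of_flipOn (A := Set.univ) fun x => ?_
  rw [forestDensity_flipOn (fun _ _ _ => by simp), flipOn_of_mem (Set.mem_univ a), spinVal_not,
    mul_neg]

theorem exp_mul_edgeSpin (t : ℝ) (x : SpinConfig V) (e : Sym2 V) :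
    Real.exp (t * edgeSpin x e) = Real.cosh t * (1 + Real.tanh t * edgeSpin x e) := by
  have hc := (Real.cosh_pos t).ne'
  rw [mul_add, mul_one, ← mul_assoc, Real.tanh_eq_sinh_div_cosh, mul_div_cancel₀ _ hc]
  rcases edgeSpin_eq_or x e with h | h <;> rw [h]
  · rw [mul_one, mul_one, Real.cosh_add_sinh]
  · rw [mul_neg, mul_one, mul_neg, mul_one, ← sub_eq_add_neg, Real.cosh_sub_sinh]

/-- The measure on a finite set with a given density with respect to the counting measure. -/
noncomputable def densityMeasure {Ω : Type*} [Fintype Ω] [MeasurableSpace Ω] (w : Ω → ℝ) :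
    Measure Ω :=
  ∑ x, ENNReal.ofReal (w x) • Measure.dirac x

theorem densityMeasure_real_singleton {Ω : Type*} [Fintype Ω] [MeasurableSpace Ω]
    [MeasurableSingletonClass Ω] {w : Ω → ℝ} (hw : ∀ x, 0 ≤ w x) (x : Ω) :
    (densityMeasure w).real {x} = w x := by
  classical
  rw [measureReal_def, densityMeasure, Measure.finsetSum_apply]
  simp_rw [Measure.smul_apply, Measure.dirac_apply, Set.indicator_apply, Set.mem_singleton_iff,
    smul_eq_mul]
  simp [hw]

theorem isProbabilityMeasure_densityMeasure {Ω : Type*} [Fintype Ω] [MeasurableSpace Ω]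
    {w : Ω → ℝ} (hw : ∀ x, 0 ≤ w x) (h1 : ∑ x, w x = 1) :
    IsProbabilityMeasure (densityMeasure w) := by
  constructor
  rw [densityMeasure, Measure.finsetSum_apply]
  simp_rw [Measure.smul_apply, measure_univ, smul_eq_mul, mul_one]
  rw [← ENNReal.ofReal_sum_of_nonneg fun x _ => hw x, h1, ENNReal.ofReal_one]

theorem abs_tanh_lt_one (t : ℝ) : |Real.tanh t| < 1 :=
  abs_lt.mpr ⟨Real.neg_one_lt_tanh t, Real.tanh_lt_one t⟩

/-- Each Boltzmann factor is `cosh θ` times a factor of the density, and the density has total mass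
one, so the partition function is `2 ^ |V| ∏ cosh (θ e)`. -/
theorem isingMeasure_eq_densityMeasure {G : SimpleGraph V} (hG : G.IsAcyclic)
    (θ : Sym2 V → ℝ) :
    isingMeasure G θ = densityMeasure (forestDensity G fun e => Real.tanh (θ e)) := by
  classical
  set c : ℝ := 2 ^ Fintype.card V * ∏ e ∈ G.edgeFinset, Real.cosh (θ e) with hc
  have hcpos : 0 < c := mul_pos (by positivity) (Finset.prod_pos fun e _ => Real.cosh_pos _)
  have hexp : ∀ y, Real.exp (edgeWeight (fun e => θ e * edgeSpin y e) G)
      = c * forestDensity G (fun e => Real.tanh (θ e)) y := by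
    intro y
    rw [edgeWeight, Real.exp_sum, forestDensity, hc, mul_mul_mul_comm,
      mul_inv_cancel₀ (by positivity), one_mul, ← Finset.prod_mul_distrib]
    exact Finset.prod_congr (by congr!) fun e _ => exp_mul_edgeSpin _ _ _
  have hZ : isingPartition G θ = c := by
    rw [isingPartition]
    simp_rw [hexp]
    rw [← Finset.mul_sum, sum_forestDensity hG, mul_one]
  rw [isingMeasure, densityMeasure]
  simp_rw [hexp, hZ, mul_div_cancel_left₀ _ hcpos.ne']

theorem isingMeasure_real_singleton {G : SimpleGraph V} (hG : G.IsAcyclic) (θ : Sym2 V → ℝ)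
    (x : SpinConfig V) :
    (isingMeasure G θ).real {x} = forestDensity G (fun e => Real.tanh (θ e)) x := by
  rw [isingMeasure_eq_densityMeasure hG]
  exact densityMeasure_real_singleton
    (forestDensity_nonneg fun e _ => (abs_tanh_lt_one _).le) x

theorem isProbabilityMeasure_isingMeasure {G : SimpleGraph V} (hG : G.IsAcyclic)
    (θ : Sym2 V → ℝ) : IsProbabilityMeasure (isingMeasure G θ) := by
  rw [isingMeasure_eq_densityMeasure hG]
  exact isProbabilityMeasure_densityMeasure
    (forestDensity_nonneg fun e _ => (abs_tanh_lt_one _).le) (sum_forestDensity hG _)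

theorem corr_eq_sum (Q : Measure (SpinConfig V)) [IsFiniteMeasure Q] (e : Sym2 V) :
    corr Q e = ∑ x, Q.real {x} * edgeSpin x e := by
  rw [corr, integral_fintype Integrable.of_finite]
  rfl

theorem abs_corr_le_one (Q : Measure (SpinConfig V)) [IsProbabilityMeasure Q] (e : Sym2 V) :
    |corr Q e| ≤ 1 := by
  rw [corr_eq_sum]
  refine (Finset.abs_sum_le_sum_abs _ _).trans ?_
  simp_rw [abs_mul, abs_edgeSpin, mul_one, abs_of_nonneg (measureReal_nonneg (μ := Q))]
  rw [sum_measureReal_singleton]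
  simp

end Density

/-! ### Pointwise Gibbs inequality and its equality case -/

section Gibbs

/-- This is `log u ≤ u - 1` at `u = b / a`. The implication `0 < a → 0 < b` plays the role of
absolute continuity: with `Real.log 0 = 0`, the right side stays finite at `b = 0`, where the
divergence is infinite. -/
theorem sub_le_mul_log_sub_log {a b : ℝ} (ha : 0 ≤ a) (hb : 0 ≤ b) (hab : 0 < a → 0 < b) :
    a - b ≤ a * (Real.log a - Real.log b) := by
  rcases ha.eq_or_lt with rfl | ha
  · simpa using hb
  · have h := Real.log_le_sub_one_of_pos (div_pos (hab ha) ha)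
    rw [Real.log_div (hab ha).ne' ha.ne'] at h
    have h2 := mul_le_mul_of_nonneg_left h ha.le
    rw [mul_sub, mul_sub, mul_one, mul_div_cancel₀ _ ha.ne'] at h2
    linarith

theorem eq_of_mul_log_sub_log_le {a b : ℝ} (ha : 0 ≤ a) (hb : 0 ≤ b) (hab : 0 < a → 0 < b)
    (h : a * (Real.log a - Real.log b) ≤ a - b) : a = b := by
  rcases ha.eq_or_lt with rfl | ha
  · simp at h
    linarith
  · by_contra hne
    have h1 : b / a ≠ 1 := fun h1 => hne ((div_eq_one_iff_eq ha.ne').mp h1).symm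
    have h' := Real.log_lt_sub_one_of_pos (div_pos (hab ha) ha) h1
    rw [Real.log_div (hab ha).ne' ha.ne'] at h'
    have h2 := mul_lt_mul_of_pos_left h' ha
    rw [mul_sub, mul_sub, mul_one, mul_div_cancel₀ _ ha.ne'] at h2
    linarith

end Gibbs

/-! ### Divergence on a finite set -/

section Finite

set_option linter.unusedSectionVars false
variable {Ω : Type*} [Fintype Ω] [MeasurableSpace Ω] [MeasurableSingletonClass Ω]

theorem llr_eq_log_div {Q R : Measure Ω} [IsFiniteMeasure Q] [IsFiniteMeasure R] (h : Q ≪ R)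
    {x : Ω} (hx : 0 < Q.real {x}) :
    0 < R.real {x} ∧ llr Q R x = Real.log (Q.real {x}) - Real.log (R.real {x}) := by
  have hR : 0 < R.real {x} := by
    refine measureReal_nonneg.lt_of_ne fun h0 => hx.ne' ?_
    rw [measureReal_def, h ((measureReal_eq_zero_iff).mp h0.symm), ENNReal.toReal_zero]
  refine ⟨hR, ?_⟩
  have h1 := Measure.setLIntegral_rnDeriv h {x}
  rw [lintegral_singleton] at h1
  have h2 := congrArg ENNReal.toReal h1
  rw [ENNReal.toReal_mul] at h2
  change _ * R.real {x} = Q.real {x} at h2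
  rw [llr, ← h2, Real.log_mul _ hR.ne', add_sub_cancel_right]
  intro h0
  rw [h0, zero_mul] at h2
  exact hx.ne h2

theorem klDiv_eq_ofReal_sum {Q R : Measure Ω} [IsProbabilityMeasure Q] [IsProbabilityMeasure R]
    (h : Q ≪ R) : InformationTheory.klDiv Q R =
      ENNReal.ofReal (∑ x, Q.real {x} * (Real.log (Q.real {x}) - Real.log (R.real {x}))) := by
  rw [InformationTheory.klDiv_of_ac_of_integrable h Integrable.of_finite,
    integral_fintype Integrable.of_finite]
  simp only [probReal_univ, add_sub_cancel_right, smul_eq_mul]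
  congr 1
  refine Finset.sum_congr rfl fun x _ => ?_
  rcases (measureReal_nonneg (μ := Q) (s := {x})).eq_or_lt with h0 | h0
  · rw [← h0, zero_mul, zero_mul]
  · rw [(llr_eq_log_div h h0).2]

theorem absolutelyContinuous_of_real_singleton {Q R : Measure Ω} [IsFiniteMeasure Q]
    [IsFiniteMeasure R] (h : ∀ x, 0 < Q.real {x} → 0 < R.real {x}) : Q ≪ R := by
  intro s hs
  rw [← Set.biUnion_of_singleton s]
  refine (measure_biUnion_null_iff s.to_countable).mpr fun x hx => ?_
  have hR : R.real {x} = 0 := by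
    rw [measureReal_def, measure_mono_null (Set.singleton_subset_iff.mpr hx) hs,
      ENNReal.toReal_zero]
  by_contra h0
  have : 0 < Q.real {x} :=
    measureReal_nonneg.lt_of_ne fun h' => h0 ((measureReal_eq_zero_iff).mp h'.symm)
  exact (h x this).ne' hR

end Finite

/-! ### Extended Ising models and the projection onto a forest -/

section Projection

set_option linter.unusedSectionVars false
variable {V : Type*} [Fintype V] [DecidableEq V]

theorem sum_mul_comp_edgeSpin (Q : Measure (SpinConfig V)) [IsProbabilityMeasure Q] (e : Sym2 V)
    (h : ℝ → ℝ) :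
    ∑ x, Q.real {x} * h (edgeSpin x e) = (1 + corr Q e) / 2 * h 1 + (1 - corr Q e) / 2 * h (-1) := by
  have h1 : ∑ x, Q.real {x} = 1 := by
    rw [sum_measureReal_singleton]; simp
  have h2 : ∀ x : SpinConfig V, Q.real {x} * h (edgeSpin x e) =
      Q.real {x} * ((h 1 + h (-1)) / 2) + (Q.real {x} * edgeSpin x e) * ((h 1 - h (-1)) / 2) := by
    intro x
    rcases edgeSpin_eq_or x e with hx | hx <;> rw [hx] <;> ring
  simp_rw [h2]
  rw [Finset.sum_add_distrib, ← Finset.sum_mul, ← Finset.sum_mul, h1, ← corr_eq_sum]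
  ring

/-- Edge correlations are finite sums, so they converge along with the point masses; the density is
polynomial in them and passes to the limit, even when the parameters diverge. -/
theorem IsExtendedIsing.real_singleton {F : SimpleGraph V} (hF : F.IsAcyclic)
    {R : Measure (SpinConfig V)} (hR : IsExtendedIsing F R) (x : SpinConfig V) :
    R.real {x} = forestDensity F (corr R) x := by
  classical
  obtain ⟨hprob, θ, hθ⟩ := hR
  simp_rw [isingMeasure_real_singleton hF] at hθ
  have hm : ∀ e ∈ F.edgeSet, Tendsto (fun k => Real.tanh (θ k e)) atTop (𝓝 (corr R e)) := by
    intro e he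
    rw [corr_eq_sum]
    have : Tendsto (fun k => ∑ x, forestDensity F (fun e => Real.tanh (θ k e)) x * edgeSpin x e)
        atTop (𝓝 (∑ x, R.real {x} * edgeSpin x e)) :=
      tendsto_finsetSum _ fun x _ => (hθ x).mul_const _
    refine this.congr fun k => ?_
    rw [sum_forestDensity_mul_edgeSpin hF _ he]
  refine tendsto_nhds_unique (hθ x) ?_
  unfold forestDensity
  refine Tendsto.const_mul _ (tendsto_finsetProd _ fun e he => ?_)
  exact ((hm e (by simpa using he)).mul_const _).const_add _

theorem isExtendedIsing_densityMeasure {F : SimpleGraph V} (hF : F.IsAcyclic) {m : Sym2 V → ℝ}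
    (hm : ∀ e, |m e| ≤ 1) : IsExtendedIsing F (densityMeasure (forestDensity F m)) := by
  have hnn := forestDensity_nonneg (G := F) fun e _ => hm e
  refine ⟨isProbabilityMeasure_densityMeasure hnn (sum_forestDensity hF m), ?_⟩
  -- Shrinking the correlations puts them strictly inside `(-1, 1)`, where real parameters exist,
  -- also when `|m e| = 1`.
  refine ⟨fun k e => Real.artanh (m e * (1 - 1 / ((k : ℝ) + 1))), fun x => ?_⟩
  rw [densityMeasure_real_singleton hnn]
  have htanh : ∀ (k : ℕ) (e : Sym2 V), Real.tanh (Real.artanh (m e * (1 - 1 / ((k : ℝ) + 1)))) =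
      m e * (1 - 1 / ((k : ℝ) + 1)) := by
    intro k e
    apply Real.tanh_artanh
    rw [Set.mem_Ioo, ← abs_lt, abs_mul]
    have h1 : 0 < 1 / ((k : ℝ) + 1) := by positivity
    have h2 : 1 / ((k : ℝ) + 1) ≤ 1 := by
      rw [div_le_one (by positivity)]; linarith [k.cast_nonneg (α := ℝ)]
    rw [abs_of_nonneg (by linarith : 0 ≤ 1 - 1 / ((k : ℝ) + 1))]
    nlinarith [hm e, abs_nonneg (m e)]
  simp_rw [isingMeasure_real_singleton hF, htanh]
  unfold forestDensity
  refine Tendsto.const_mul _ (tendsto_finsetProd _ fun e he => ?_)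
  have : Tendsto (fun k : ℕ => m e * (1 - 1 / ((k : ℝ) + 1))) atTop (𝓝 (m e * (1 - 0))) :=
    (tendsto_one_div_add_atTop_nhds_zero_nat.const_sub 1).const_mul _
  rw [sub_zero, mul_one] at this
  exact (this.mul_const _).const_add _

/-- Half of this quantity is the `Q`-probability that the spin product along `e` equals its value at
`x`, an event that contains the atom `x`. It makes `Q` absolutely continuous with respect to its
projection. -/
theorem one_add_corr_mul_edgeSpin_pos (Q : Measure (SpinConfig V)) [IsProbabilityMeasure Q]
    {x : SpinConfig V} (hx : 0 < Q.real {x}) (e : Sym2 V) : 0 < 1 + corr Q e * edgeSpin x e := by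
  have h1 := sum_mul_comp_edgeSpin Q e fun y => 1 + y * edgeSpin x e
  have h2 : Q.real {x} * (1 + edgeSpin x e * edgeSpin x e) ≤
      ∑ y, Q.real {y} * (1 + edgeSpin y e * edgeSpin x e) := by
    refine Finset.single_le_sum (f := fun y => Q.real {y} * (1 + edgeSpin y e * edgeSpin x e))
      (fun y _ => mul_nonneg measureReal_nonneg ?_) (Finset.mem_univ x)
    exact one_add_mul_edgeSpin_nonneg (abs_edgeSpin y e).le x e
  rw [h1, edgeSpin_mul_self] at h2
  linarith

/-- Gibbs' inequality for the spin product along one edge. -/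
theorem sum_log_one_add_sub_nonneg (Q : Measure (SpinConfig V)) [IsProbabilityMeasure Q]
    (e : Sym2 V) {m : ℝ} (hm : |m| ≤ 1) (h : ∀ x, 0 < Q.real {x} → 0 < 1 + m * edgeSpin x e) :
    0 ≤ ∑ x, Q.real {x} *
      (Real.log (1 + corr Q e * edgeSpin x e) - Real.log (1 + m * edgeSpin x e)) ∧
    (∑ x, Q.real {x} *
      (Real.log (1 + corr Q e * edgeSpin x e) - Real.log (1 + m * edgeSpin x e)) = 0 →
        m = corr Q e) := by
  set c := corr Q e with hc
  obtain ⟨hm1, hm2⟩ := abs_le.mp hm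
  obtain ⟨hc1, hc2⟩ := abs_le.mp (abs_corr_le_one Q e)
  rw [← hc] at hc1 hc2
  -- If `1 + m * s` vanishes, no configuration charged by `Q` has spin product `s` along `e`, and
  -- then `1 + c * s` vanishes as well.
  have key : ∀ s : ℝ, (s = 1 ∨ s = -1) → 0 < 1 + c * s → 0 < 1 + m * s := by
    intro s hs hpos
    by_contra hneg
    have hz : ∀ x, Q.real {x} * (1 + edgeSpin x e * s) = 0 := by
      intro x
      rcases (measureReal_nonneg (μ := Q) (s := {x})).eq_or_lt with h0 | h0
      · rw [← h0, zero_mul]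
      · have h' := h x h0
        rcases edgeSpin_eq_or x e with hx | hx <;> rcases hs with rfl | rfl <;>
          simp [hx] at h' hneg ⊢ <;> linarith
    have h1 := sum_mul_comp_edgeSpin Q e fun y => 1 + y * s
    rw [Finset.sum_eq_zero fun x _ => hz x, ← hc] at h1
    linarith
  have k1 := key 1 (Or.inl rfl)
  have k2 := key (-1) (Or.inr rfl)
  rw [sum_mul_comp_edgeSpin Q e fun y => Real.log (1 + c * y) - Real.log (1 + m * y), ← hc]
  simp only [mul_one, mul_neg, ← sub_eq_add_neg] at k1 k2 ⊢
  have i1 := sub_le_mul_log_sub_log (by linarith) (by linarith) k1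
  have i2 := sub_le_mul_log_sub_log (by linarith) (by linarith) k2
  refine ⟨by linarith, fun h0 => ?_⟩
  have := eq_of_mul_log_sub_log_le (a := 1 + c) (b := 1 + m) (by linarith) (by linarith) k1
    (by linarith)
  linarith

theorem IsExtendedIsing.abs_corr_le_one {F : SimpleGraph V} {R : Measure (SpinConfig V)}
    (hR : IsExtendedIsing F R) (e : Sym2 V) : |corr R e| ≤ 1 :=
  have := hR.1
  _root_.abs_corr_le_one R e

theorem pos_of_forestDensity_pos {F : SimpleGraph V} {m : Sym2 V → ℝ} (hm : ∀ e, |m e| ≤ 1)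
    {x : SpinConfig V} (h : 0 < forestDensity F m x) {e : Sym2 V} (he : e ∈ F.edgeSet) :
    0 < 1 + m e * edgeSpin x e := by
  classical
  refine (one_add_mul_edgeSpin_nonneg (hm e) x e).lt_of_ne fun h0 => h.ne' ?_
  rw [forestDensity, Finset.prod_eq_zero (i := e) (by simpa using he) h0.symm, mul_zero]

theorem log_forestDensity {F : SimpleGraph V} {m : Sym2 V → ℝ} {x : SpinConfig V}
    [Fintype F.edgeSet] (h : ∀ e ∈ F.edgeSet, 0 < 1 + m e * edgeSpin x e) :
    Real.log (forestDensity F m x) = Real.log (2 ^ Fintype.card V)⁻¹ +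
      ∑ e ∈ F.edgeFinset, Real.log (1 + m e * edgeSpin x e) := by
  classical
  have h' : ∀ e ∈ F.edgeFinset, 1 + m e * edgeSpin x e ≠ 0 := fun e he =>
    (h e (by simpa using he)).ne'
  have h'' : forestDensity F m x = (2 ^ Fintype.card V)⁻¹ *
    ∏ e ∈ F.edgeFinset, (1 + m e * edgeSpin x e) := by
    unfold forestDensity
    congr!
  rw [h'', Real.log_mul (by positivity) (Finset.prod_ne_zero_iff.mpr h'), Real.log_prod h']

/-- A Pythagorean identity: the excess divergence of any competitor over the matching density is a
sum over the edges of divergences between two-point laws. Each is nonnegative and vanishes only if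
the correlations agree, which gives minimality and uniqueness together. -/
theorem isIsingProjection_densityMeasure {F : SimpleGraph V} (hF : F.IsAcyclic)
    (Q : Measure (SpinConfig V)) [IsProbabilityMeasure Q] :
    IsIsingProjection F Q (densityMeasure (forestDensity F (corr Q))) ∧
      ∀ R', IsIsingProjection F Q R' → R' = densityMeasure (forestDensity F (corr Q)) := by
  classical
  have hc := abs_corr_le_one Q
  have hR := isExtendedIsing_densityMeasure hF hc
  have hRs := densityMeasure_real_singleton (forestDensity_nonneg (G := F) fun e _ => hc e)
  set R := densityMeasure (forestDensity F (corr Q)) with hRdef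
  have := hR.1
  have hpos : ∀ x, 0 < Q.real {x} → 0 < R.real {x} := by
    intro x hx
    rw [hRs]
    exact mul_pos (by positivity) (Finset.prod_pos fun e _ =>
      one_add_corr_mul_edgeSpin_pos Q hx e)
  have hac : Q ≪ R := absolutelyContinuous_of_real_singleton hpos
  have hdiff : ∀ R', IsExtendedIsing F R' → Q ≪ R' →
      ∑ x, Q.real {x} * (Real.log (Q.real {x}) - Real.log (R'.real {x})) =
      ∑ x, Q.real {x} * (Real.log (Q.real {x}) - Real.log (R.real {x})) +
      ∑ e ∈ F.edgeFinset, ∑ x, Q.real {x} * (Real.log (1 + corr Q e * edgeSpin x e) -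
        Real.log (1 + corr R' e * edgeSpin x e)) := by
    intro R' hR' hac'
    have := hR'.1
    rw [Finset.sum_comm, ← Finset.sum_add_distrib]
    refine Finset.sum_congr rfl fun x _ => ?_
    rcases (measureReal_nonneg (μ := Q) (s := {x})).eq_or_lt with h0 | h0
    · simp [← h0]
    · have h1 := (llr_eq_log_div hac' h0).1
      rw [hR'.real_singleton hF] at h1 ⊢
      rw [hRs, log_forestDensity (F := F) (m := corr Q)
        (fun e _ => one_add_corr_mul_edgeSpin_pos Q h0 e),
        log_forestDensity fun e he => pos_of_forestDensity_pos hR'.abs_corr_le_one h1 he,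
        ← Finset.mul_sum, Finset.sum_sub_distrib]
      ring
  have hgibbs : ∀ R', IsExtendedIsing F R' → Q ≪ R' → ∀ e ∈ F.edgeFinset, _ :=
    fun R' hR' hac' e he => sum_log_one_add_sub_nonneg Q e (m := corr R' e)
      (hR'.abs_corr_le_one e) fun x hx => by
        have := hR'.1
        have h1 := (llr_eq_log_div hac' hx).1
        rw [hR'.real_singleton hF] at h1
        exact pos_of_forestDensity_pos hR'.abs_corr_le_one h1 (by simpa using he)
  refine ⟨⟨hR, fun R' hR' => ?_⟩, fun R' hR' => ?_⟩
  · have := hR'.1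
    by_cases hac' : Q ≪ R'
    · rw [klDiv_eq_ofReal_sum hac, klDiv_eq_ofReal_sum hac', hdiff R' hR' hac']
      exact ENNReal.ofReal_le_ofReal (le_add_of_nonneg_right
        (Finset.sum_nonneg fun e he => (hgibbs R' hR' hac' e he).1))
    · rw [InformationTheory.klDiv_of_not_ac hac']
      exact le_top
  · have hle := hR'.2 R hR
    have hE := hR'.1
    have := hE.1
    have hac' : Q ≪ R' := by
      by_contra h
      rw [InformationTheory.klDiv_of_not_ac h, klDiv_eq_ofReal_sum hac] at hle
      exact absurd hle (by simp)
    -- `ENNReal.ofReal` truncates at zero, so the inequality of divergences transfers to the real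
    -- sums only once the larger side is known to be nonnegative.
    have hnn : 0 ≤ ∑ x, Q.real {x} * (Real.log (Q.real {x}) - Real.log (R.real {x})) := by
      have h := InformationTheory.integral_llr_add_sub_measure_univ_nonneg hac Integrable.of_finite
      rw [integral_fintype Integrable.of_finite] at h
      simp only [probReal_univ, add_sub_cancel_right, smul_eq_mul] at h
      refine h.trans_eq (Finset.sum_congr rfl fun x _ => ?_)
      rcases (measureReal_nonneg (μ := Q) (s := {x})).eq_or_lt with h0 | h0
      · rw [← h0, zero_mul, zero_mul]
      · rw [(llr_eq_log_div hac h0).2]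
    rw [klDiv_eq_ofReal_sum hac, klDiv_eq_ofReal_sum hac',
      ENNReal.ofReal_le_ofReal_iff hnn, hdiff R' hE hac'] at hle
    have hsum := Finset.sum_nonneg fun e he => (hgibbs R' hE hac' e he).1
    have hz := (Finset.sum_eq_zero_iff_of_nonneg fun e he => (hgibbs R' hE hac' e he).1).mp
      (le_antisymm (by linarith) hsum)
    refine Measure.ext_of_measureReal_singleton fun x => ?_
    rw [hRs, hE.real_singleton hF]
    exact forestDensity_congr
      (fun e he => (hgibbs R' hE hac' e (by simpa using he)).2 (hz e (by simpa using he))) x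

end Projection

/-! ### Total variation of pair marginals -/

section TotalVariation

set_option linter.unusedSectionVars false
variable {V : Type*} [Fintype V] [DecidableEq V]

theorem measureReal_eq_sum_indicator {Ω : Type*} [Fintype Ω] [MeasurableSpace Ω]
    [MeasurableSingletonClass Ω] (P : Measure Ω) [IsFiniteMeasure P] (A : Set Ω)
    [DecidablePred (· ∈ A)] : P.real A = ∑ x, if x ∈ A then P.real {x} else 0 := by
  rw [← Finset.sum_filter, sum_measureReal_singleton]
  congr 1
  ext x
  simp

theorem map_restrict_pair_real_singleton (P : Measure (SpinConfig V)) [IsProbabilityMeasure P]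
    (h0 : ∀ a, ∑ x, P.real {x} * spinVal (x a) = 0) {S : Finset V} {a b : V} (hab : a ≠ b)
    (hS : S = {a, b}) (y : S → Bool) :
    (P.map fun x (i : S) => x i).real {y} =
      (1 + corr P s(a, b) * (spinVal (y ⟨a, by simp [hS]⟩) * spinVal (y ⟨b, by simp [hS]⟩))) / 4 := by
  classical
  rw [map_measureReal_apply (Measurable.of_discrete) (measurableSet_singleton y),
    measureReal_eq_sum_indicator]
  set ya := y ⟨a, by simp [hS]⟩ with hya
  set yb := y ⟨b, by simp [hS]⟩ with hyb
  have hmem : ∀ x : SpinConfig V, x ∈ (fun x (i : S) => x i) ⁻¹' {y} ↔ x a = ya ∧ x b = yb := by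
    intro x
    rw [Set.mem_preimage, Set.mem_singleton_iff]
    constructor
    · rintro rfl
      exact ⟨rfl, rfl⟩
    · rintro ⟨h1, h2⟩
      funext ⟨i, hi⟩
      have : i = a ∨ i = b := by simpa [hS] using hi
      rcases this with rfl | rfl
      · exact h1
      · exact h2
  -- The indicator of `x a = ya`, `x b = yb` is `(1 + x a * ya) * (1 + x b * yb) / 4` in spin
  -- values.
  have hterm : ∀ x : SpinConfig V,
      (if x ∈ (fun x (i : S) => x i) ⁻¹' {y} then P.real {x} else 0) =
      (P.real {x} + P.real {x} * spinVal (x a) * spinVal ya + P.real {x} * spinVal (x b) * spinVal yb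
        + P.real {x} * edgeSpin x s(a, b) * (spinVal ya * spinVal yb)) / 4 := by
    intro x
    simp only [hmem, edgeSpin_mk]
    cases x a <;> cases x b <;> cases ya <;> cases yb <;> simp [spinVal] <;> ring
  simp_rw [hterm]
  rw [← Finset.sum_div, Finset.sum_add_distrib, Finset.sum_add_distrib, Finset.sum_add_distrib,
    ← Finset.sum_mul, ← Finset.sum_mul, ← Finset.sum_mul, h0, h0, ← corr_eq_sum,
    sum_measureReal_singleton]
  simp

theorem tvDist_restrict_pair (P R : Measure (SpinConfig V)) [IsProbabilityMeasure P]
    [IsProbabilityMeasure R] (hP : ∀ a, ∑ x, P.real {x} * spinVal (x a) = 0)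
    (hR : ∀ a, ∑ x, R.real {x} * spinVal (x a) = 0) {S : Finset V} {a b : V} (hab : a ≠ b)
    (hS : S = {a, b}) :
    tvDist (P.map fun x (i : S) => x i) (R.map fun x (i : S) => x i) =
      |corr P s(a, b) - corr R s(a, b)| / 2 := by
  have hterm : ∀ y : S → Bool, |(P.map fun x (i : S) => x i).real {y} -
      (R.map fun x (i : S) => x i).real {y}| = |corr P s(a, b) - corr R s(a, b)| / 4 := by
    intro y
    rw [map_restrict_pair_real_singleton P hP hab hS, map_restrict_pair_real_singleton R hR hab hS,
      ← sub_div, add_sub_add_left_eq_sub, ← sub_mul, abs_div, abs_mul, abs_mul]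
    have habs : ∀ b, |spinVal b| = 1 := fun b => by cases b <;> simp [spinVal]
    rw [habs, habs]
    norm_num
  have hcard : Fintype.card (S → Bool) = 4 := by
    rw [Fintype.card_fun, Fintype.card_coe, hS, Finset.card_pair hab, Fintype.card_bool]
    norm_num
  unfold tvDist
  simp_rw [hterm]
  rw [Finset.sum_const, Finset.card_univ, hcard]
  simp only [nsmul_eq_mul]
  push_cast
  ring

theorem smallSetTV_two_lt (P R : Measure (SpinConfig V)) [IsProbabilityMeasure P]
    [IsProbabilityMeasure R] (hP : ∀ a, ∑ x, P.real {x} * spinVal (x a) = 0)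
    (hR : ∀ a, ∑ x, R.real {x} * spinVal (x a) = 0) {η : ℝ} (hη : 0 < η)
    (h : ∀ a b, a ≠ b → |corr P s(a, b) - corr R s(a, b)| < 2 * η) :
    smallSetTV 2 P R < η := by
  unfold smallSetTV
  rcases isEmpty_or_nonempty {S : Finset V // S.card = 2} with hE | hE
  · rwa [Real.iSup_of_isEmpty]
  -- A finite supremum is attained, so the strict inequality survives it.
  · obtain ⟨⟨S, hS⟩, hmax⟩ := exists_eq_ciSup_of_finite
      (f := fun S : {S : Finset V // S.card = 2} =>
        tvDist (P.map fun x (i : S.1) => x i) (R.map fun x (i : S.1) => x i))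
    rw [← hmax]
    obtain ⟨a, b, hab, rfl⟩ := Finset.card_eq_two.mp hS
    rw [tvDist_restrict_pair P R hP hR hab rfl]
    linarith [h a b hab]

end TotalVariation

/-! ### Independent samples: Markov, Chernoff and sign averaging -/

section Sampling

set_option linter.unusedSectionVars false
variable {Ω : Type*} [Fintype Ω] {n : ℕ}

theorem sum_pi_prod_mul_prod (w f : Ω → ℝ) :
    ∑ X : Fin n → Ω, (∏ l, w (X l)) * ∏ l, f (X l) = (∑ x, w x * f x) ^ n := by
  classical
  simp_rw [← Finset.prod_mul_distrib]
  rw [← Fintype.prod_sum fun (_ : Fin n) x => w x * f x, Finset.prod_const, Finset.card_univ,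
    Fintype.card_fin]

variable [MeasurableSpace Ω] [MeasurableSingletonClass Ω]

theorem pi_real_singleton (P : Measure Ω) [IsProbabilityMeasure P] (X : Fin n → Ω) :
    (Measure.pi fun _ : Fin n => P).real {X} = ∏ l, P.real {X l} := by
  rw [measureReal_def, Measure.pi_singleton, ENNReal.toReal_prod]
  rfl

/-- Markov's inequality for `n` independent samples from a finite set. -/
theorem pi_real_le_sum (P : Measure Ω) [IsProbabilityMeasure P] {A : Set (Fin n → Ω)}
    {g : (Fin n → Ω) → ℝ} (h0 : ∀ X, 0 ≤ g X) (h1 : ∀ X ∈ A, 1 ≤ g X) :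
    (Measure.pi fun _ : Fin n => P).real A ≤ ∑ X, (∏ l, P.real {X l}) * g X := by
  classical
  rw [measureReal_eq_sum_indicator]
  refine Finset.sum_le_sum fun X _ => ?_
  rw [pi_real_singleton]
  have hnn : 0 ≤ ∏ l, P.real {X l} := Finset.prod_nonneg fun _ _ => measureReal_nonneg
  split_ifs with h
  · exact le_mul_of_one_le_right hnn (h1 X h)
  · exact mul_nonneg hnn (h0 X)

/-- Chernoff's bound for sums of independent samples. -/
theorem pi_real_le_pow (P : Measure Ω) [IsProbabilityMeasure P] {A : Set (Fin n → Ω)}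
    (f : Ω → ℝ) (c : ℝ) (h1 : ∀ X ∈ A, c ≤ ∑ l, f (X l)) :
    (Measure.pi fun _ : Fin n => P).real A ≤
      Real.exp (-c) * (∑ x, P.real {x} * Real.exp (f x)) ^ n := by
  refine (pi_real_le_sum P (g := fun X => Real.exp (-c) * ∏ l, Real.exp (f (X l)))
    (fun X => by positivity) fun X hX => ?_).trans_eq ?_
  · rw [← Real.exp_sum, ← Real.exp_add]
    exact Real.one_le_exp (by linarith [h1 X hX])
  · rw [← sum_pi_prod_mul_prod, Finset.mul_sum]
    exact Finset.sum_congr rfl fun X _ => by ring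

/-- Integrating out the signs `y (X l)` when each sample carries a sign-reversing symmetry. -/
theorem sum_pi_mul_prod_sign (φ : Equiv.Perm Ω) (y g : Ω → ℝ) (m : ℝ)
    (hy : ∀ x, y x = 1 ∨ y x = -1) (hφy : ∀ x, y (φ x) = -y x) (hφg : ∀ x, g (φ x) = g x)
    (B : (Fin n → Ω) → ℝ) (K : (Fin n → Ω) → ℝ → ℝ)
    (hB : ∀ (s : Fin n → Bool) X, B (fun l => if s l then φ (X l) else X l) = B X)
    (hK : ∀ (s : Fin n → Bool) X, K (fun l => if s l then φ (X l) else X l) = K X) :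
    ∑ X : Fin n → Ω, (∏ l, g (X l) * (1 + m * y (X l))) * (B X * ∏ l, K X (y (X l))) =
      ∑ X : Fin n → Ω, (∏ l, g (X l)) * (B X * ((1 + m) / 2 * K X 1 + (1 - m) / 2 * K X (-1)) ^ n) := by
  classical
  set L : (Fin n → Ω) → ℝ :=
    fun X => (∏ l, g (X l) * (1 + m * y (X l))) * (B X * ∏ l, K X (y (X l))) with hL
  let Φ : (Fin n → Bool) → Equiv.Perm (Fin n → Ω) := fun s =>
    Equiv.piCongrRight fun l => if s l then φ else Equiv.refl Ω
  have hΦ : ∀ s X, Φ s X = fun l => if s l then φ (X l) else X l := by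
    intro s X
    funext l
    change (if s l then φ else Equiv.refl Ω) (X l) = _
    split_ifs <;> rfl
  -- Applying `φ` to any subset of the samples permutes the sample space. Averaging over all `2 ^ n`
  -- subsets makes the signs independent for fixed `X`, so the average factorizes over the samples.
  have havg : ∀ s, ∑ X, L (Φ s X) = ∑ X, L X := fun s => Equiv.sum_comp (Φ s) L
  have hsum : ∑ s : Fin n → Bool, ∑ X, L (Φ s X) = 2 ^ n * ∑ X, L X := by
    simp_rw [havg]
    rw [Finset.sum_const, Finset.card_univ, Fintype.card_fun, Fintype.card_fin, Fintype.card_bool,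
      nsmul_eq_mul]
    push_cast
    rfl
  have hterm : ∀ X, ∑ s : Fin n → Bool, L (Φ s X) = 2 ^ n * ((∏ l, g (X l)) *
      (B X * ((1 + m) / 2 * K X 1 + (1 - m) / 2 * K X (-1)) ^ n)) := by
    intro X
    have h1 : ∀ s : Fin n → Bool, L (Φ s X) = ((∏ l, g (X l)) * B X) *
        ∏ l, (fun (l : Fin n) (t : Bool) => (1 + m * (if t then -y (X l) else y (X l))) *
          K X (if t then -y (X l) else y (X l))) l (s l) := by
      intro s
      have hg : ∀ l, g (if s l then φ (X l) else X l) = g (X l) := fun l => by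
        split_ifs <;> simp [hφg]
      have hyy : ∀ l, y (if s l then φ (X l) else X l) = if s l then -y (X l) else y (X l) :=
        fun l => by split_ifs <;> simp [hφy]
      simp only [hL, hΦ, hB, hK, hg, hyy, Finset.prod_mul_distrib]
      ring
    simp_rw [h1]
    rw [← Finset.mul_sum, ← Fintype.prod_sum fun (l : Fin n) (t : Bool) =>
      (1 + m * (if t then -y (X l) else y (X l))) * K X (if t then -y (X l) else y (X l))]
    have h2 : ∀ l : Fin n, ∑ t : Bool, (1 + m * (if t then -y (X l) else y (X l))) *
          K X (if t then -y (X l) else y (X l)) =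
        2 * ((1 + m) / 2 * K X 1 + (1 - m) / 2 * K X (-1)) := by
      intro l
      rcases hy (X l) with h | h <;> simp [h] <;> ring
    rw [Finset.prod_congr rfl fun l _ => h2 l, Finset.prod_const, Finset.card_univ,
      Fintype.card_fin, mul_pow]
    ring
  rw [Finset.sum_comm, Finset.sum_congr rfl fun X _ => hterm X, ← Finset.mul_sum] at hsum
  exact (mul_left_cancel₀ (by positivity) hsum).symm

end Sampling

/-! ### Moment generating function of one sign -/

section Scalar

/-- A Bernstein-type bound for the centred moment generating function of a sign of mean `m`. -/
theorem centred_sign_mgf_le {m t : ℝ} (hm : |m| ≤ 1) (ht : |t| ≤ 1 / 2) :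
    (1 + m) / 2 * Real.exp (t * (1 - m)) + (1 - m) / 2 * Real.exp (t * (-1 - m)) ≤
      Real.exp (t ^ 2 * (1 - m ^ 2)) := by
  obtain ⟨hm1, hm2⟩ := abs_le.mp hm
  -- With `|t| ≤ 1 / 2` both exponents lie in `[-1, 1]`. In the mean the linear terms cancel and the
  -- quadratic ones give the variance `1 - m ^ 2`.
  have hq : ∀ x : ℝ, |x| ≤ 1 → Real.exp x ≤ 1 + x + x ^ 2 := fun x hx => by
    have := Real.abs_exp_sub_one_sub_id_le hx
    linarith [(abs_le.mp this).2]
  have h1 := hq (t * (1 - m)) (by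
    rw [abs_mul, abs_of_nonneg (by linarith : 0 ≤ 1 - m)]
    nlinarith [abs_nonneg t])
  have h2 := hq (t * (-1 - m)) (by
    rw [abs_mul, abs_of_nonpos (by linarith : -1 - m ≤ 0)]
    nlinarith [abs_nonneg t])
  have h3 := mul_le_mul_of_nonneg_left h1 (by linarith : 0 ≤ (1 + m) / 2)
  have h4 := mul_le_mul_of_nonneg_left h2 (by linarith : 0 ≤ (1 - m) / 2)
  have h5 := Real.add_one_le_exp (t ^ 2 * (1 - m ^ 2))
  nlinarith

end Scalar

/-! ### Deviation bounds for empirical correlations and their products -/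

section Deviation

/-- The left side is the mean of `exp (-m * x)` for a sign `x` of mean `m`. Both sides are even, and
on `[0, ∞)` their difference has derivative `-(x * (cosh x - 1)) ≤ 0`. -/
theorem cosh_sub_mul_sinh_le (m : ℝ) : Real.cosh m - m * Real.sinh m ≤ 1 - m ^ 2 / 2 := by
  have hder : ∀ x : ℝ, HasDerivAt (fun x => Real.cosh x - x * Real.sinh x + x ^ 2 / 2)
      (-(x * (Real.cosh x - 1))) x := by
    intro x
    have h := ((Real.hasDerivAt_cosh x).sub ((hasDerivAt_id x).mul (Real.hasDerivAt_sinh x))).add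
      (((hasDerivAt_id x).pow 2).div_const 2)
    exact h.congr_deriv (by simp only [id, Nat.cast_ofNat]; ring)
  have hanti : AntitoneOn (fun x => Real.cosh x - x * Real.sinh x + x ^ 2 / 2) (Set.Ici 0) := by
    refine antitoneOn_of_deriv_nonpos (convex_Ici 0)
      (fun x _ => (hder x).continuousAt.continuousWithinAt)
      (fun x _ => (hder x).differentiableAt.differentiableWithinAt) fun x hx => ?_
    rw [interior_Ici] at hx
    rw [(hder x).deriv]
    have := mul_nonneg (Set.mem_Ioi.mp hx).le (sub_nonneg.mpr (Real.one_le_cosh x))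
    linarith
  have h := hanti Set.self_mem_Ici (abs_nonneg m) (abs_nonneg m)
  have h2 : |m| * Real.sinh |m| = m * Real.sinh m := by
    rcases abs_cases m with ⟨h, _⟩ | ⟨h, _⟩ <;> rw [h]
    rw [Real.sinh_neg, neg_mul_neg]
  simp only [Real.cosh_abs, h2, sq_abs, Real.cosh_zero] at h
  norm_num at h
  linarith

set_option linter.unusedSectionVars false
variable {V : Type*} [Fintype V] [DecidableEq V] {n : ℕ}

theorem corr_empiricalDist (X : Fin n → SpinConfig V) (e : Sym2 V) :
    corr (empiricalDist X) e = (∑ l, edgeSpin (X l) e) / n := by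
  rw [corr, empiricalDist, integral_smul_measure,
    integral_finsetSum_measure fun i _ => Integrable.of_finite]
  simp only [integral_dirac, smul_eq_mul, ENNReal.toReal_inv, ENNReal.toReal_natCast]
  rw [div_eq_inv_mul]

theorem isProbabilityMeasure_empiricalDist (hn : n ≠ 0) (X : Fin n → SpinConfig V) :
    IsProbabilityMeasure (empiricalDist X) := by
  constructor
  rw [empiricalDist, Measure.smul_apply, Measure.finsetSum_apply]
  simp only [measure_univ, Finset.sum_const, Finset.card_univ, Fintype.card_fin, nsmul_eq_mul,
    mul_one, smul_eq_mul]
  exact ENNReal.inv_mul_cancel (by simpa using hn) (ENNReal.natCast_ne_top n)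

theorem sum_exp_edgeSpin_sub_corr_le (P : Measure (SpinConfig V)) [IsProbabilityMeasure P]
    (e : Sym2 V) (t : ℝ) :
    ∑ x, P.real {x} * Real.exp (t * (edgeSpin x e - corr P e)) ≤ Real.exp (t ^ 2 / 2) := by
  have h := (ProbabilityTheory.hasSubgaussianMGF_of_mem_Icc (μ := P)
    (X := fun x => edgeSpin x e) (a := -1) (b := 1) (Measurable.of_discrete).aemeasurable
    (ae_of_all _ fun x => abs_le.mp (abs_edgeSpin x e).le)).mgf_le t
  rw [ProbabilityTheory.mgf, integral_fintype Integrable.of_finite] at h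
  refine le_trans (le_of_eq ?_) (h.trans (le_of_eq ?_))
  · rfl
  · congr 1
    norm_num

/-- Hoeffding's inequality for the empirical correlations. -/
theorem pi_real_corr_deviation_le (P : Measure (SpinConfig V)) [IsProbabilityMeasure P]
    (hn : n ≠ 0) (e : Sym2 V) {ε : ℝ} (hε : 0 < ε) :
    (Measure.pi fun _ : Fin n => P).real
      {X | ε < |corr (empiricalDist X) e - corr P e|} ≤ 2 * Real.exp (-(n * ε ^ 2 / 2)) := by
  have hn' : (0 : ℝ) < n := by positivity
  have hone : ∀ s : ℝ, s ^ 2 = 1 → (Measure.pi fun _ : Fin n => P).real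
      {X | ε < s * (corr (empiricalDist X) e - corr P e)} ≤ Real.exp (-(n * ε ^ 2 / 2)) := by
    intro s hs
    refine (pi_real_le_pow P (fun x => (ε * s) * (edgeSpin x e - corr P e)) (n * ε ^ 2)
      fun X hX => ?_).trans ?_
    · rw [Set.mem_ofPred_eq, corr_empiricalDist] at hX
      rw [← Finset.mul_sum, Finset.sum_sub_distrib, Finset.sum_const, Finset.card_univ,
        Fintype.card_fin, nsmul_eq_mul]
      have h : (∑ l, edgeSpin (X l) e) - n * corr P e =
          n * ((∑ l, edgeSpin (X l) e) / n - corr P e) := by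
        rw [mul_sub, mul_div_cancel₀ _ hn'.ne']
      rw [h]
      nlinarith [mul_pos hn' hε]
    · have h1 := sum_exp_edgeSpin_sub_corr_le P e (ε * s)
      have h2 : 0 ≤ ∑ x, P.real {x} * Real.exp ((ε * s) * (edgeSpin x e - corr P e)) :=
        Finset.sum_nonneg fun x _ => mul_nonneg measureReal_nonneg (Real.exp_pos _).le
      refine (mul_le_mul_of_nonneg_left (pow_le_pow_left₀ h2 h1 n) (Real.exp_pos _).le).trans
        (le_of_eq ?_)
      rw [← Real.exp_nat_mul, ← Real.exp_add, mul_pow, hs]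
      congr 1
      ring
  have hsub : {X : Fin n → SpinConfig V | ε < |corr (empiricalDist X) e - corr P e|} ⊆
      {X | ε < 1 * (corr (empiricalDist X) e - corr P e)} ∪
      {X | ε < -1 * (corr (empiricalDist X) e - corr P e)} := by
    intro X hX
    rcases lt_abs.mp (Set.mem_ofPred_eq ▸ hX) with h | h
    · exact Or.inl (by simpa using h)
    · exact Or.inr (by simpa using h)
  refine (measureReal_mono hsub).trans ((measureReal_union_le _ _).trans ?_)
  linarith [hone 1 (by norm_num), hone (-1) (by norm_num)]

/-- A tree edge `f` beats, with high probability, the pair `e` whose spin product is `x f` times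
the product over the edge set `U`. -/
theorem pi_real_abs_corr_le_abs_corr {T : SimpleGraph V} (hT : T.IsAcyclic) (m : Sym2 V → ℝ)
    (P : Measure (SpinConfig V)) [IsProbabilityMeasure P]
    (hP : ∀ x, P.real {x} = forestDensity T m x) (hn : n ≠ 0) {f e : Sym2 V}
    {U : Finset (Sym2 V)} (hf : f ∈ T.edgeSet) (hU : ∀ g ∈ U, g ∈ T.edgeSet) (hfU : f ∉ U)
    (he : ∀ x, edgeSpin x e = edgeSpin x f * ∏ g ∈ U, edgeSpin x g) :
    (Measure.pi fun _ : Fin n => P).real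
      {X | |corr (empiricalDist X) f| ≤ |corr (empiricalDist X) e|} ≤
        2 * Real.exp (-(n * ((1 - |∏ g ∈ U, m g|) * m f ^ 2 / 4))) := by
  have hn' : (0 : ℝ) < n := by positivity
  set A : SpinConfig V → ℝ := fun x => ∏ g ∈ U, edgeSpin x g with hA
  have hA1 : ∀ x, A x = 1 ∨ A x = -1 := fun x => by
    rw [← mul_self_eq_one_iff, hA, ← Finset.prod_mul_distrib]
    exact Finset.prod_eq_one fun g _ => edgeSpin_mul_self x g
  have e0 : ∑ x, P.real {x} = 1 := by simp_rw [hP]; exact sum_forestDensity hT m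
  have eA : ∑ x, P.real {x} * A x = ∏ g ∈ U, m g := by
    simp_rw [hP]; exact sum_forestDensity_mul_prod hT m hU
  have ef : ∑ x, P.real {x} * edgeSpin x f = m f := by
    simp_rw [hP]; exact sum_forestDensity_mul_edgeSpin hT m hf
  have efA : ∑ x, P.real {x} * (edgeSpin x f * A x) = m f * ∏ g ∈ U, m g := by
    rw [← Finset.prod_insert hfU]
    rw [← sum_forestDensity_mul_prod hT m fun g hg => by
      rcases Finset.mem_insert.mp hg with rfl | h
      exacts [hf, hU g h]]
    exact Finset.sum_congr rfl fun x _ => by rw [hP, Finset.prod_insert hfU]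
  set M := ∏ g ∈ U, m g with hM
  have hM1 : |M| ≤ 1 := by
    rw [← eA]
    refine (Finset.abs_sum_le_sum_abs _ _).trans (le_of_eq ?_)
    rw [← e0]
    refine Finset.sum_congr rfl fun x _ => ?_
    rw [abs_mul, abs_of_nonneg measureReal_nonneg]
    rcases hA1 x with h | h <;> simp [h]
  have hone : ∀ s : ℝ, s = 1 ∨ s = -1 → (Measure.pi fun _ : Fin n => P).real
      {X | m f * (corr (empiricalDist X) f - s * corr (empiricalDist X) e) ≤ 0} ≤
        Real.exp (-(n * ((1 - |M|) * m f ^ 2 / 4))) := by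
    intro s hs
    refine (pi_real_le_pow P (fun x => -(m f / 2 * (edgeSpin x f * (1 - s * A x)))) 0
      fun X hX => ?_).trans ?_
    · rw [Set.mem_ofPred_eq, corr_empiricalDist, corr_empiricalDist, mul_div_assoc', ← sub_div,
        mul_div_assoc', div_nonpos_iff] at hX
      have hX' : m f * (∑ l, edgeSpin (X l) f - s * ∑ l, edgeSpin (X l) e) ≤ 0 := by
        rcases hX with h | h
        · linarith
        · exact h.1
      rw [Finset.mul_sum, ← Finset.sum_sub_distrib, Finset.mul_sum] at hX'
      rw [Finset.sum_neg_distrib]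
      have : ∑ l, m f / 2 * (edgeSpin (X l) f * (1 - s * A (X l))) =
          (∑ l, m f * (edgeSpin (X l) f - s * edgeSpin (X l) e)) / 2 := by
        rw [Finset.sum_div]
        refine Finset.sum_congr rfl fun l _ => ?_
        rw [he]
        ring
      rw [this]
      linarith
    -- As `1 - s * A` is `0` or `2`, the exponential is `1` when `A = s` and `exp (-m f * x f)`
    -- otherwise. The independence of `x f` and `A` then gives `hsum`.
    · have hterm : ∀ x, P.real {x} * Real.exp (-(m f / 2 * (edgeSpin x f * (1 - s * A x)))) =
          P.real {x} * ((1 + Real.cosh (m f)) / 2) +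
          P.real {x} * A x * (s * (1 - Real.cosh (m f)) / 2) -
          P.real {x} * edgeSpin x f * (Real.sinh (m f) / 2) +
          P.real {x} * (edgeSpin x f * A x) * (s * Real.sinh (m f) / 2) := by
        intro x
        have h1 := Real.cosh_add_sinh (m f)
        have h2 := Real.cosh_sub_sinh (m f)
        rcases hA1 x with h | h <;> rcases edgeSpin_eq_or x f with h' | h' <;>
          rcases hs with rfl | rfl <;> rw [h, h'] <;> norm_num <;> (try rw [← h1]) <;>
          (try rw [← h2]) <;> ring
      have hsum : ∑ x, P.real {x} * Real.exp (-(m f / 2 * (edgeSpin x f * (1 - s * A x)))) =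
          (1 + s * M) / 2 + (1 - s * M) / 2 * (Real.cosh (m f) - m f * Real.sinh (m f)) := by
        simp_rw [hterm]
        rw [Finset.sum_add_distrib, Finset.sum_sub_distrib, Finset.sum_add_distrib,
          ← Finset.sum_mul, ← Finset.sum_mul, ← Finset.sum_mul, ← Finset.sum_mul, e0, eA, ef, efA]
        ring
      have hsM : s * M ≤ |M| := by
        rcases hs with rfl | rfl
        · simpa using le_abs_self M
        · simpa using neg_le_abs M
      have hle : ∑ x, P.real {x} * Real.exp (-(m f / 2 * (edgeSpin x f * (1 - s * A x)))) ≤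
          Real.exp (-((1 - |M|) * m f ^ 2 / 4)) := by
        rw [hsum]
        have h1 := mul_le_mul_of_nonneg_left (cosh_sub_mul_sinh_le (m f))
          (by linarith : 0 ≤ (1 - s * M) / 2)
        have h2 := Real.add_one_le_exp (-((1 - |M|) * m f ^ 2 / 4))
        nlinarith [sq_nonneg (m f)]
      have h0 : 0 ≤ ∑ x, P.real {x} * Real.exp (-(m f / 2 * (edgeSpin x f * (1 - s * A x)))) :=
        Finset.sum_nonneg fun x _ => mul_nonneg measureReal_nonneg (Real.exp_pos _).le
      rw [neg_zero, Real.exp_zero, one_mul]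
      refine (pow_le_pow_left₀ h0 hle n).trans (le_of_eq ?_)
      rw [← Real.exp_nat_mul, mul_neg]
  have hsub : {X : Fin n → SpinConfig V |
        |corr (empiricalDist X) f| ≤ |corr (empiricalDist X) e|} ⊆
      {X | m f * (corr (empiricalDist X) f - 1 * corr (empiricalDist X) e) ≤ 0} ∪
      {X | m f * (corr (empiricalDist X) f - (-1) * corr (empiricalDist X) e) ≤ 0} := by
    intro X hX
    -- Comparing squares gives `(a - b) * (a + b) ≤ 0`, so `m f * (a - b)` and `m f * (a + b)`
    -- cannot both be positive.
    have hX' := sq_le_sq.mpr (Set.mem_ofPred_eq ▸ hX)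
    by_contra h
    simp only [Set.mem_union, Set.mem_ofPred_eq, not_or, not_le] at h
    have := mul_pos h.1 h.2
    nlinarith [sq_nonneg (m f)]
  refine (measureReal_mono hsub).trans ((measureReal_union_le _ _).trans ?_)
  linarith [hone 1 (Or.inl rfl), hone (-1) (Or.inr rfl)]

/-- The moment generating function of the error of a product of empirical edge correlations is
bounded independently of the number of edges. -/
theorem sum_pi_exp_prod_sub_prod_le {T : SimpleGraph V} (hT : T.IsAcyclic) {m : Sym2 V → ℝ}
    (hm : ∀ e, |m e| ≤ 1) (hn : n ≠ 0) (S : Finset (Sym2 V)) (hS : ∀ e ∈ S, e ∈ T.edgeSet) :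
    ∀ t : ℝ, |t| ≤ n / 2 → ∑ X : Fin n → SpinConfig V, (∏ l, forestDensity T m (X l)) *
      Real.exp (t * (∏ e ∈ S, corr (empiricalDist X) e - ∏ e ∈ S, m e)) ≤
        Real.exp (t ^ 2 / n) := by
  classical
  have hn' : (0 : ℝ) < n := by positivity
  induction S using Finset.induction_on with
  | empty =>
    intro t _
    have h := sum_pi_prod_mul_prod (n := n) (forestDensity T m) fun _ => 1
    simp only [Finset.prod_const_one, mul_one, sum_forestDensity hT, one_pow] at h
    simp only [Finset.prod_empty, sub_self, mul_zero, Real.exp_zero, mul_one, h]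
    exact Real.one_le_exp (by positivity)
  | insert f S hf ih =>
    intro t ht
    have hS' : ∀ e ∈ S, e ∈ T.edgeSet := fun e he => hS e (Finset.mem_insert_of_mem he)
    have hfT : f ∈ T.edgeSet := hS f (Finset.mem_insert_self _ _)
    obtain ⟨A, hA⟩ := hT.exists_isCut hfT
    -- The error splits as `Z * (corr f - m f) + m f * (Z - M)`, with the empirical correlation of
    -- `f`. Flips across the cut of `f` leave `Z` unchanged, so the first term is a centred sum of
    -- signs given `Z`.
    set Z : (Fin n → SpinConfig V) → ℝ := fun X => ∏ e ∈ S, corr (empiricalDist X) e with hZ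
    set g : SpinConfig V → ℝ := fun x =>
      (2 ^ Fintype.card V)⁻¹ * ∏ e ∈ T.edgeFinset.erase f, (1 + m e * edgeSpin x e) with hg
    have hgd : ∀ x, forestDensity T m x = g x * (1 + m f * edgeSpin x f) := by
      intro x
      rw [hg, mul_assoc, Finset.prod_erase_mul _ _ (by simpa using hfT), forestDensity]
    have hg0 : ∀ x, 0 ≤ g x := fun x => mul_nonneg (by positivity)
      (Finset.prod_nonneg fun e _ => one_add_mul_edgeSpin_nonneg (hm e) x e)
    have hgA : ∀ x, g (flipOn A x) = g x := fun x => by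
      simp only [hg]
      congr 1
      refine Finset.prod_congr rfl fun e he => ?_
      obtain ⟨h1, h2⟩ := Finset.mem_erase.mp he
      rw [hA.edgeSpin_flipOn_of_ne (by simpa using h2) h1]
    have hZA : ∀ (s : Fin n → Bool) X, Z (fun l => if s l then flipOn A (X l) else X l) = Z X := by
      intro s X
      refine Finset.prod_congr rfl fun e he => ?_
      rw [corr_empiricalDist, corr_empiricalDist]
      congr 1
      refine Finset.sum_congr rfl fun l _ => ?_
      split_ifs
      · exact hA.edgeSpin_flipOn_of_ne (hS' e he) (fun h => hf (h ▸ he)) _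
      · rfl
    have hZ1 : ∀ X, |Z X| ≤ 1 := fun X => by
      have := isProbabilityMeasure_empiricalDist hn X
      rw [hZ, Finset.abs_prod]
      exact Finset.prod_le_one (fun _ _ => abs_nonneg _) fun e _ => abs_corr_le_one _ e
    set M := ∏ e ∈ S, m e with hM
    set B : (Fin n → SpinConfig V) → ℝ := fun X => Real.exp (t * m f * (Z X - M)) with hB
    have hBA : ∀ (s : Fin n → Bool) X, B (fun l => if s l then flipOn A (X l) else X l) = B X :=
      fun s X => by simp only [hB, hZA]
    -- With trivial `K` the same averaging, read backwards, restores the factors of `f` and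
    -- identifies the sum against `g` with an expectation under the full density.
    have hone := sum_pi_mul_prod_sign (n := n) (flipOn A) (fun x => edgeSpin x f) g (m f)
      (fun x => edgeSpin_eq_or x f) hA.edgeSpin_flipOn_self hgA B (fun _ _ => 1) hBA
      fun _ _ => rfl
    have hexp := sum_pi_mul_prod_sign (n := n) (flipOn A) (fun x => edgeSpin x f) g (m f)
      (fun x => edgeSpin_eq_or x f) hA.edgeSpin_flipOn_self hgA B
      (fun X y => Real.exp (t * Z X / n * (y - m f))) hBA fun s X => by simp only [hZA]
    -- The second term of the split carries the tilt `t * m f`; hence the induction runs over all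
    -- `t`.
    have hbase := ih hS' (t * m f) (by
      rw [abs_mul]
      exact (mul_le_of_le_one_right (abs_nonneg t) (hm f)).trans ht)
    have hlhs : ∀ X : Fin n → SpinConfig V, (∏ l, forestDensity T m (X l)) *
        Real.exp (t * (∏ e ∈ insert f S, corr (empiricalDist X) e - ∏ e ∈ insert f S, m e)) =
        (∏ l, g (X l) * (1 + m f * edgeSpin (X l) f)) *
          (B X * ∏ l, Real.exp (t * Z X / n * (edgeSpin (X l) f - m f))) := by
      intro X
      simp only [hgd]
      congr 1
      rw [← Real.exp_sum, ← Real.exp_add, Finset.prod_insert hf, Finset.prod_insert hf]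
      congr 1
      rw [← Finset.mul_sum, Finset.sum_sub_distrib, Finset.sum_const, Finset.card_univ,
        Fintype.card_fin, nsmul_eq_mul, corr_empiricalDist]
      change t * ((∑ l, edgeSpin (X l) f) / n * Z X - m f * M) = _
      field_simp
      ring
    rw [Finset.sum_congr rfl fun X _ => hlhs X, hexp]
    have hstep : ∀ X : Fin n → SpinConfig V, ((1 + m f) / 2 * Real.exp (t * Z X / n * (1 - m f)) +
        (1 - m f) / 2 * Real.exp (t * Z X / n * (-1 - m f))) ^ n ≤
          Real.exp (t ^ 2 / n * (1 - m f ^ 2)) := by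
      intro X
      obtain ⟨h1, h2⟩ := abs_le.mp (hm f)
      have hle := centred_sign_mgf_le (hm f) (t := t * Z X / n) (by
        rw [abs_div, abs_mul, Nat.abs_cast, div_le_iff₀ hn']
        have := mul_le_of_le_one_right (abs_nonneg t) (hZ1 X)
        linarith)
      refine (pow_le_pow_left₀ (add_nonneg (mul_nonneg (by linarith) (Real.exp_pos _).le)
        (mul_nonneg (by linarith) (Real.exp_pos _).le)) hle n).trans ?_
      rw [← Real.exp_nat_mul]
      refine Real.exp_le_exp.mpr ?_
      have hZ2 : Z X ^ 2 ≤ 1 := (sq_le_one_iff_abs_le_one _).mpr (hZ1 X)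
      have hm2 : 0 ≤ 1 - m f ^ 2 := sub_nonneg.mpr ((sq_le_one_iff_abs_le_one _).mpr (hm f))
      have : n * ((t * Z X / n) ^ 2 * (1 - m f ^ 2)) = t ^ 2 / n * (1 - m f ^ 2) * Z X ^ 2 := by
        field_simp
      rw [this]
      exact mul_le_of_le_one_right (mul_nonneg (by positivity) hm2) hZ2
    have hfin : ∑ X : Fin n → SpinConfig V, (∏ l, g (X l)) * B X ≤
        Real.exp ((t * m f) ^ 2 / n) := by
      refine le_trans (le_of_eq ?_) hbase
      have h1 : (1 + m f) / 2 + (1 - m f) / 2 = 1 := by ring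
      simp only [mul_one, h1, one_pow, Finset.prod_const_one] at hone
      rw [← hone]
      simp only [hgd, hB, hZ]
    calc _ ≤ ∑ X : Fin n → SpinConfig V, (∏ l, g (X l)) * B X *
            Real.exp (t ^ 2 / n * (1 - m f ^ 2)) := by
          refine Finset.sum_le_sum fun X _ => ?_
          rw [← mul_assoc]
          exact mul_le_mul_of_nonneg_left (hstep X) (mul_nonneg
            (Finset.prod_nonneg fun l _ => hg0 _) (Real.exp_pos _).le)
      _ ≤ Real.exp ((t * m f) ^ 2 / n) * Real.exp (t ^ 2 / n * (1 - m f ^ 2)) := by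
          rw [← Finset.sum_mul]
          exact mul_le_mul_of_nonneg_right hfin (Real.exp_pos _).le
      -- The variance factors `m f ^ 2` and `1 - m f ^ 2` add up to `1`, so the bound does not grow
      -- with the number of edges.
      _ = Real.exp (t ^ 2 / n) := by
          rw [← Real.exp_add]
          congr 1
          field_simp
          ring

theorem pi_real_prod_deviation_le {T : SimpleGraph V} (hT : T.IsAcyclic) {m : Sym2 V → ℝ}
    (hm : ∀ e, |m e| ≤ 1) (P : Measure (SpinConfig V)) [IsProbabilityMeasure P]
    (hP : ∀ x, P.real {x} = forestDensity T m x) (hn : n ≠ 0) {S : Finset (Sym2 V)}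
    (hS : ∀ e ∈ S, e ∈ T.edgeSet) {η : ℝ} (hη : 0 < η) (hη1 : η ≤ 1) :
    (Measure.pi fun _ : Fin n => P).real
      {X | η < |∏ e ∈ S, corr (empiricalDist X) e - ∏ e ∈ S, m e|} ≤
        2 * Real.exp (-(n * η ^ 2 / 4)) := by
  have hn' : (0 : ℝ) < n := by positivity
  have hone : ∀ s : ℝ, |s| = 1 → (Measure.pi fun _ : Fin n => P).real
      {X | η < s * (∏ e ∈ S, corr (empiricalDist X) e - ∏ e ∈ S, m e)} ≤
        Real.exp (-(n * η ^ 2 / 4)) := by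
    intro s hs
    have hs2 : s ^ 2 = 1 := by rw [← sq_abs, hs, one_pow]
    -- The tilt `n * η / 2` minimizes `t ^ 2 / n - t * η`; `η ≤ 1` keeps it in the admissible range.
    have hmgf := sum_pi_exp_prod_sub_prod_le hT hm hn S hS (n * η / 2 * s) (by
      rw [abs_mul, hs, mul_one, abs_of_nonneg (by positivity)]
      nlinarith)
    refine (pi_real_le_sum P (g := fun X => Real.exp (-(n * η ^ 2 / 2)) *
      Real.exp (n * η / 2 * s * (∏ e ∈ S, corr (empiricalDist X) e - ∏ e ∈ S, m e)))
      (fun X => by positivity) fun X hX => ?_).trans ?_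
    · rw [Set.mem_ofPred_eq] at hX
      rw [← Real.exp_add]
      refine Real.one_le_exp ?_
      rw [mul_assoc]
      nlinarith [mul_pos hn' hη]
    · simp_rw [hP, mul_left_comm _ (Real.exp (-(n * η ^ 2 / 2)))]
      rw [← Finset.mul_sum]
      refine (mul_le_mul_of_nonneg_left hmgf (Real.exp_pos _).le).trans (le_of_eq ?_)
      rw [← Real.exp_add, mul_pow, hs2]
      congr 1
      field_simp
      ring
  have hsub : {X : Fin n → SpinConfig V |
      η < |∏ e ∈ S, corr (empiricalDist X) e - ∏ e ∈ S, m e|} ⊆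
      {X | η < 1 * (∏ e ∈ S, corr (empiricalDist X) e - ∏ e ∈ S, m e)} ∪
      {X | η < -1 * (∏ e ∈ S, corr (empiricalDist X) e - ∏ e ∈ S, m e)} := by
    intro X hX
    rcases lt_abs.mp (Set.mem_ofPred_eq ▸ hX) with h | h
    · exact Or.inl (by simpa using h)
    · exact Or.inr (by simpa using h)
  refine (measureReal_mono hsub).trans ((measureReal_union_le _ _).trans ?_)
  linarith [hone 1 (by norm_num), hone (-1) (by norm_num)]

end Deviation

/-! ### Exchange in spanning trees -/

section SpanningTrees

set_option linter.unusedSectionVars false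
variable {V : Type*}

/-- The new edge closes a cycle through `e`, so `e` is no bridge and its deletion keeps the graph
connected; the number of edges is that of a tree. -/
theorem SimpleGraph.IsTree.exchange [Finite V] {S : SimpleGraph V} (hS : S.IsTree) {u v : V}
    (hne : u ≠ v) (huv : ¬S.Adj u v) {p : S.Walk u v} (hp : p.IsPath) {e : Sym2 V}
    (he : e ∈ p.edges) : ((S ⊔ SimpleGraph.edge u v).deleteEdges {e}).IsTree := by
  set H := S ⊔ SimpleGraph.edge u v with hH
  have hle : S ≤ H := le_sup_left
  have hHuv : H.Adj v u := Or.inr (by simp [SimpleGraph.edge_adj, hne.symm])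
  have heS : e ∈ S.edgeSet := p.edges_subset_edgeSet he
  have hconn : H.Connected := hS.connected.mono hle
  have hcyc : (SimpleGraph.Walk.cons hHuv (p.mapLe hle)).IsCycle := by
    rw [SimpleGraph.Walk.cons_isCycle_iff]
    refine ⟨hp.mapLe hle, fun h => huv ?_⟩
    rw [SimpleGraph.Walk.edges_mapLe_eq_edges] at h
    exact (p.edges_subset_edgeSet h : S.Adj v u).symm
  have hnb : ¬H.IsBridge e := by
    rw [SimpleGraph.isBridge_iff_forall_cycle_notMem (SimpleGraph.edgeSet_mono hle heS)]
    intro h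
    refine h _ hcyc ?_
    rw [SimpleGraph.Walk.edges_cons, SimpleGraph.Walk.edges_mapLe_eq_edges]
    exact List.mem_cons_of_mem _ he
  have hdel : (H.deleteEdges {e}).Connected := by
    induction e with
    | h a b => exact hconn.connected_delete_edge_of_not_isBridge hnb
  have hcard := (SimpleGraph.isTree_iff_connected_and_card.mp hS).2
  refine SimpleGraph.isTree_iff_connected_and_card.mpr ⟨hdel, ?_⟩
  rw [← hcard]
  congr 1
  have hset : (H.deleteEdges {e}).edgeSet = insert s(u, v) S.edgeSet \ {e} := by
    rw [SimpleGraph.edgeSet_deleteEdges, hH, SimpleGraph.edgeSet_sup,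
      SimpleGraph.edgeSet_edge_of_ne hne, Set.union_singleton]
  rw [Nat.card_coe_set_eq, Nat.card_coe_set_eq, hset,
    Set.ncard_sdiff_singleton_of_mem (Set.mem_insert_of_mem _ heS),
    Set.ncard_insert_of_notMem (by simpa using huv), Nat.add_sub_cancel]

variable [Fintype V] [DecidableEq V]

theorem edgeWeight_exchange (w : Sym2 V → ℝ) {S : SimpleGraph V} {u v : V} (hne : u ≠ v)
    (huv : ¬S.Adj u v) {e : Sym2 V} (he : e ∈ S.edgeSet) :
    edgeWeight w ((S ⊔ SimpleGraph.edge u v).deleteEdges {e}) =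
      edgeWeight w S + w s(u, v) - w e := by
  classical
  have hset : ((S ⊔ SimpleGraph.edge u v).deleteEdges {e}).edgeFinset =
      (insert s(u, v) S.edgeFinset).erase e := by
    ext x
    simp only [SimpleGraph.mem_edgeFinset, SimpleGraph.edgeSet_deleteEdges, SimpleGraph.edgeSet_sup,
      SimpleGraph.edgeSet_edge_of_ne hne, Finset.mem_erase, Finset.mem_insert, Set.mem_sdiff,
      Set.mem_union, Set.mem_singleton_iff]
    tauto
  have h1 : edgeWeight w S = ∑ x ∈ S.edgeFinset, w x := by
    unfold edgeWeight; congr!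
  have h2 : edgeWeight w ((S ⊔ SimpleGraph.edge u v).deleteEdges {e}) =
      ∑ x ∈ ((S ⊔ SimpleGraph.edge u v).deleteEdges {e}).edgeFinset, w x := by
    unfold edgeWeight; congr!
  rw [h1, h2, hset, Finset.sum_erase_eq_sub (by simp [he]), Finset.sum_insert (by simpa using huv)]
  ring

/-- A tree edge that outweighs every pair joined through it belongs to all maximum spanning
trees. -/
theorem IsMaxSpanningTree.mem_edgeSet {w : Sym2 V → ℝ} {S T : SimpleGraph V}
    (hS : IsMaxSpanningTree w S) (hT : T.IsTree) {f : Sym2 V} (hf : f ∈ T.edgeSet)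
    (h : ∀ (a b : V) (p : T.Walk a b), p.IsPath → f ∈ p.edges → s(a, b) ≠ f →
      w s(a, b) < w f) : f ∈ S.edgeSet := by
  by_contra hfS
  obtain ⟨A, hA⟩ := hT.isAcyclic.exists_isCut hf
  induction f with
  | h u v =>
    obtain ⟨p, hp⟩ := hS.1.connected.exists_isPath u v
    -- The path of `S` between the ends of `f` crosses the cut of `f` in `T` at some `s(c, d)`. The
    -- path of `T` from `c` to `d` runs through `f`, so `s(c, d)` is lighter, and exchanging it for
    -- `f` would increase the weight of `S`.
    obtain ⟨c, d, hcd, hcross⟩ := exists_crossing_mem_edges p (hA.1 u v rfl)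
    have hcdS : s(c, d) ∈ S.edgeSet := p.edges_subset_edgeSet hcd
    obtain ⟨q, hq⟩ := hT.connected.exists_isPath c d
    have hlt := h c d q hq (hA.mem_edges q hcross) (fun heq => hfS (heq ▸ hcdS))
    have hne : u ≠ v := (show T.Adj u v from hf).ne
    have hle := hS.2 _ (hS.1.exchange hne hfS hp hcd)
    rw [edgeWeight_exchange w hne hfS hcdS] at hle
    linarith

/-- In the acyclic graph `S` the edge is a bridge, so every walk of `S` between its ends uses it, in
particular `q`, which is also a walk of `T`. -/
theorem mem_edgeSet_of_path_edges_mem {S T : SimpleGraph V} (hS : S.IsAcyclic) {a b : V}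
    (hab : s(a, b) ∈ S.edgeSet) (q : T.Walk a b) (hq : ∀ e ∈ q.edges, e ∈ S.edgeSet) :
    s(a, b) ∈ T.edgeSet := by
  have hb := SimpleGraph.isAcyclic_iff_forall_isBridge.mp hS hab
  rw [SimpleGraph.isBridge_iff_forall_walk_mem_edges] at hb
  have h := hb (q.transfer S hq)
  rw [SimpleGraph.Walk.edges_transfer] at h
  exact q.edges_subset_edgeSet h

theorem exists_isTruncationOutput {n : ℕ} [Nonempty V] (X : Fin n → SpinConfig V) (s : ℝ) :
    ∃ F, IsTruncationOutput X s F := by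
  obtain ⟨T, -, hT⟩ := (SimpleGraph.connected_top (V := V)).exists_isTree_le
  obtain ⟨S, hS, hmax⟩ := Set.exists_max_image {S : SimpleGraph V | S.IsTree}
    (edgeWeight fun e => |corr (empiricalDist X) e|) (Set.toFinite _) ⟨T, hT⟩
  exact ⟨_, S, ⟨hS, hmax⟩, rfl⟩

end SpanningTrees

/-! ### Structure and pairwise error of the truncated tree -/

section Truncation

set_option linter.unusedSectionVars false
variable {V : Type*} [Fintype V] [DecidableEq V] {n : ℕ}

theorem abs_prod_le_abs_of_mem {U : Finset (Sym2 V)} {m : Sym2 V → ℝ} (hm : ∀ e ∈ U, |m e| ≤ 1)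
    {g : Sym2 V} (hg : g ∈ U) : |∏ e ∈ U, m e| ≤ |m g| := by
  rw [← Finset.mul_prod_erase U m hg, abs_mul, Finset.abs_prod]
  exact mul_le_of_le_one_right (abs_nonneg _) (Finset.prod_le_one (fun _ _ => abs_nonneg _)
    fun e he => hm e (Finset.mem_of_mem_erase he))

theorem corr_eq_of_real_singleton {T : SimpleGraph V} (hT : T.IsAcyclic) {m : Sym2 V → ℝ}
    {P : Measure (SpinConfig V)} [IsProbabilityMeasure P]
    (hP : ∀ x, P.real {x} = forestDensity T m x) {e : Sym2 V} (he : e ∈ T.edgeSet) :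
    corr P e = m e := by
  rw [corr_eq_sum]
  simp_rw [hP]
  exact sum_forestDensity_mul_edgeSpin hT m he

theorem corr_eq_prod_path {T : SimpleGraph V} (hT : T.IsAcyclic) {m : Sym2 V → ℝ}
    {P : Measure (SpinConfig V)} [IsProbabilityMeasure P]
    (hP : ∀ x, P.real {x} = forestDensity T m x) {a b : V} {p : T.Walk a b} (hp : p.IsPath) :
    corr P s(a, b) = ∏ e ∈ p.edges.toFinset, m e := by
  rw [corr_eq_sum]
  simp_rw [hP]
  exact sum_forestDensity_mul_edgeSpin_path hT m hp

/-- The structural properties of the truncated tree on the event that the empirical correlations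
are `ε`-accurate and that the strong tree edges beat all pairs joined through them. -/
theorem IsTruncationOutput.isAcyclic_and_subset_and_superset {T : SimpleGraph V} (hT : T.IsTree) {m : Sym2 V → ℝ}
    (hm : ∀ e, |m e| ≤ 1) {P : Measure (SpinConfig V)} [IsProbabilityMeasure P]
    (hP : ∀ x, P.real {x} = forestDensity T m x) {ε τ : ℝ} (hε : 0 ≤ ε)
    {X : Fin n → SpinConfig V}
    (hdev : ∀ e : Sym2 V, ¬e.IsDiag → |corr (empiricalDist X) e - corr P e| ≤ ε)
    (hstrong : ∀ f ∈ T.edgeSet, τ ≤ |m f| → ∀ (a b : V) (p : T.Walk a b), p.IsPath →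
      f ∈ p.edges → s(a, b) ≠ f → |corr (empiricalDist X) s(a, b)| < |corr (empiricalDist X) f|)
    {F : SimpleGraph V} (hF : IsTruncationOutput X (τ + ε) F) :
    F.IsAcyclic ∧ F.edgeSet ⊆ T.edgeSet ∧
      ∀ e ∈ T.edgeSet, τ + 2 * ε ≤ |corr P e| → e ∈ F.edgeSet := by
  obtain ⟨S, hS, rfl⟩ := hF
  have hmem : ∀ e, e ∈ (SimpleGraph.fromEdgeSet
      {e | e ∈ S.edgeSet ∧ τ + ε ≤ |corr (empiricalDist X) e|}).edgeSet ↔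
      e ∈ S.edgeSet ∧ τ + ε ≤ |corr (empiricalDist X) e| := by
    intro e
    rw [SimpleGraph.edgeSet_fromEdgeSet]
    exact ⟨fun h => h.1, fun h => ⟨h, S.not_isDiag_of_mem_edgeSet h.1⟩⟩
  have hS_of : ∀ f ∈ T.edgeSet, τ ≤ |m f| → f ∈ S.edgeSet := fun f hf hτ =>
    hS.mem_edgeSet hT hf fun a b p hp hfp hne => hstrong f hf hτ a b p hp hfp hne
  refine ⟨hS.1.isAcyclic.anti (SimpleGraph.edgeSet_subset_edgeSet.mp fun e he =>
    ((hmem e).mp he).1), fun e he => ?_, fun e he hτ => (hmem e).mpr ?_⟩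
  · obtain ⟨heS, hτ⟩ := (hmem e).mp he
    have hd := hdev e (S.not_isDiag_of_mem_edgeSet heS)
    have hcorr : τ ≤ |corr P e| := by
      have := abs_sub_abs_le_abs_sub (corr (empiricalDist X) e) (corr P e)
      linarith
    induction e with
    | h a b =>
      obtain ⟨q, hq⟩ := hT.connected.exists_isPath a b
      refine mem_edgeSet_of_path_edges_mem hS.1.isAcyclic heS q fun g hg => ?_
      -- A product of numbers in `[-1, 1]` that reaches `τ` in absolute value has every factor at
      -- least `τ` in absolute value, so each edge of the path is strong.
      rw [corr_eq_prod_path hT.isAcyclic hP hq] at hcorr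
      exact hS_of g (q.edges_subset_edgeSet hg)
        (hcorr.trans (abs_prod_le_abs_of_mem (fun e _ => hm e) (List.mem_toFinset.mpr hg)))
  · have hd := hdev e (T.not_isDiag_of_mem_edgeSet he)
    have h1 := abs_sub_abs_le_abs_sub (corr P e) (corr (empiricalDist X) e)
    rw [abs_sub_comm] at h1
    refine ⟨hS_of e he ?_, by linarith⟩
    rw [← corr_eq_of_real_singleton hT.isAcyclic hP he]
    linarith

/-- The pairwise error of the projection onto a subforest of the tree. -/
theorem abs_corr_sub_corr_lt {T F : SimpleGraph V} (hT : T.IsTree) {m c : Sym2 V → ℝ}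
    (hm : ∀ e, |m e| ≤ 1) {P R : Measure (SpinConfig V)} [IsProbabilityMeasure P]
    [IsProbabilityMeasure R] (hP : ∀ x, P.real {x} = forestDensity T m x)
    (hR : ∀ x, R.real {x} = forestDensity F c x) (hFT : F.edgeSet ⊆ T.edgeSet) {η : ℝ}
    (hη : 0 < η) (hweak : ∀ e ∈ T.edgeSet, e ∉ F.edgeSet → |m e| < 2 * η)
    (hprod : ∀ (a b : V) (p : T.Walk a b), p.IsPath →
      |∏ e ∈ p.edges.toFinset, c e - ∏ e ∈ p.edges.toFinset, m e| ≤ η) (a b : V) :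
    |corr P s(a, b) - corr R s(a, b)| < 2 * η := by
  have hle : F ≤ T := SimpleGraph.edgeSet_subset_edgeSet.mp hFT
  have hF : F.IsAcyclic := hT.isAcyclic.anti hle
  by_cases hab : F.Reachable a b
  · obtain ⟨p, hp⟩ := hab.exists_isPath
    have h := hprod a b (p.mapLe hle) (hp.mapLe hle)
    rw [← corr_eq_prod_path hT.isAcyclic hP (hp.mapLe hle),
      SimpleGraph.Walk.edges_mapLe_eq_edges, ← corr_eq_prod_path hF hR hp, abs_sub_comm] at h
    linarith
  · obtain ⟨q, hq⟩ := hT.connected.exists_isPath a b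
    have hR0 : corr R s(a, b) = 0 := by
      rw [corr_eq_sum]
      simp_rw [hR]
      exact sum_forestDensity_mul_edgeSpin_of_not_reachable F c hab
    have : ∃ g ∈ q.edges, g ∉ F.edgeSet := by
      by_contra h
      push Not at h
      exact hab (q.transfer F h).reachable
    obtain ⟨g, hg, hgF⟩ := this
    rw [hR0, sub_zero, corr_eq_prod_path hT.isAcyclic hP hq]
    exact (abs_prod_le_abs_of_mem (fun e _ => hm e) (List.mem_toFinset.mpr hg)).trans_lt
      (hweak g (q.edges_subset_edgeSet hg) hgF)

/-- Ensures that the product over the path without `f` is not empty, so that it is bounded by `tanh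
β` rather than by `1`. -/
theorem exists_mem_edges_ne {T : SimpleGraph V} {a b : V} {p : T.Walk a b} (hp : p.IsPath)
    {f : Sym2 V} (hf : f ∈ p.edges) (hne : s(a, b) ≠ f) : ∃ g ∈ p.edges, g ≠ f := by
  by_contra h
  push Not at h
  have hnd := hp.isTrail.edges_nodup
  cases p with
  | nil => simp at hf
  | cons huv q =>
    cases q with
    | nil => simp at hf; exact hne hf.symm
    | cons hvw q' =>
      rw [SimpleGraph.Walk.edges_cons, SimpleGraph.Walk.edges_cons] at h hnd
      have h1 := h _ (List.mem_cons_self)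
      have h2 := h _ (List.mem_cons_of_mem _ List.mem_cons_self)
      rw [h1, h2] at hnd
      simp at hnd

theorem measureReal_iUnion_le_card_mul {Ω ι : Type*} [MeasurableSpace Ω] [Fintype ι]
    (μ : Measure Ω) [IsFiniteMeasure μ] (A : ι → Set Ω) {c : ℝ} (h : ∀ i, μ.real (A i) ≤ c) :
    μ.real (⋃ i, A i) ≤ Fintype.card ι * c := by
  refine (measureReal_iUnion_fintype_le A).trans ((Finset.sum_le_sum fun i _ => h i).trans ?_)
  rw [Finset.sum_const, nsmul_eq_mul, Finset.card_univ]

end Truncation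

/-! ### Numerical estimates for `ε` and `τ` -/

section Constants

theorem abs_tanh_le_tanh {t β : ℝ} (h : |t| ≤ β) : |Real.tanh t| ≤ Real.tanh β := by
  have hmono : ∀ {x y : ℝ}, x ≤ y → Real.tanh x ≤ Real.tanh y := fun {x y} hxy => by
    rwa [← Real.artanh_le_artanh_iff ⟨Real.neg_one_lt_tanh x, Real.tanh_lt_one x⟩
      ⟨Real.neg_one_lt_tanh y, Real.tanh_lt_one y⟩, Real.artanh_tanh, Real.artanh_tanh]
  obtain ⟨h1, h2⟩ := abs_le.mp h
  exact abs_le.mpr ⟨Real.tanh_neg β ▸ hmono h1, hmono h2⟩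

theorem exp_neg_two_mul_le_one_sub_tanh {β : ℝ} (hβ : 0 ≤ β) :
    Real.exp (-(2 * β)) ≤ 1 - Real.tanh β := by
  have hc := Real.cosh_pos β
  rw [Real.tanh_eq_sinh_div_cosh, one_sub_div hc.ne', Real.cosh_sub_sinh, le_div_iff₀ hc,
    Real.cosh_eq, mul_div_assoc', div_le_iff₀ two_pos, mul_add, ← Real.exp_add, ← Real.exp_add]
  have h1 : Real.exp (-(2 * β) + β) = Real.exp (-β) := by congr 1; ring
  have h2 : Real.exp (-(2 * β) + -β) ≤ Real.exp (-β) := Real.exp_le_exp.mpr (by linarith)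
  rw [h1]
  linarith

theorem log_two_mul_sq_div_pos {p : ℕ} (hp : p ≠ 0) {δ : ℝ} (hδ : 0 < δ) (hδ1 : δ < 1) :
    0 < Real.log (2 * (p : ℝ) ^ 2 / δ) := by
  have hp1 : (1 : ℝ) ≤ p := by exact_mod_cast Nat.one_le_iff_ne_zero.mpr hp
  refine Real.log_pos ((one_lt_div hδ).mpr ?_)
  nlinarith

theorem exp_neg_log_two_mul_sq_div {p : ℕ} (hp : p ≠ 0) {δ : ℝ} (hδ : 0 < δ) :
    Real.exp (-Real.log (2 * (p : ℝ) ^ 2 / δ)) = δ / (2 * (p : ℝ) ^ 2) := by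
  rw [Real.exp_neg, Real.exp_log (by positivity), inv_div]

theorem devLevel_pos {n p : ℕ} (hn : n ≠ 0) (hp : p ≠ 0) {δ : ℝ} (hδ : 0 < δ) (hδ1 : δ < 1) :
    0 < devLevel n p δ := by
  have := log_two_mul_sq_div_pos hp hδ hδ1
  unfold devLevel
  positivity

theorem mul_devLevel_sq {n p : ℕ} (hn : n ≠ 0) (hp : p ≠ 0) {δ : ℝ} (hδ : 0 < δ) (hδ1 : δ < 1) :
    n * devLevel n p δ ^ 2 = 2 * Real.log (2 * (p : ℝ) ^ 2 / δ) := by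
  have := log_two_mul_sq_div_pos hp hδ hδ1
  rw [devLevel, Real.sq_sqrt (by positivity)]
  field_simp

theorem truncThreshold_sq_mul (n p : ℕ) (β δ : ℝ) :
    truncThreshold n p β δ ^ 2 * (1 - Real.tanh β) = 16 * devLevel n p δ ^ 2 := by
  have h : 0 < 1 - Real.tanh β := by linarith [Real.tanh_lt_one β]
  rw [truncThreshold, div_pow, Real.sq_sqrt h.le, div_mul_cancel₀ _ h.ne']
  ring

/-- Since `√(1 - tanh β) ≥ exp (-β)`, the left side is at most `6 * ε * exp β`. Its square times `n`
is at most `216 * exp (2 * β) * log (p / δ)`, against more than `256 * exp (2 * β) * log (p / δ)`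
for `2 * η`. -/
theorem truncThreshold_add_lt {n p : ℕ} (hn : n ≠ 0) (hp : 2 ≤ p) {β η δ : ℝ} (hβ : 0 ≤ β)
    (hη : 0 < η) (hδ : 0 < δ) (hδ1 : δ < 1)
    (h : 64 * Real.exp (2 * β) * Real.log (p / δ) < n * η ^ 2) :
    truncThreshold n p β δ + 2 * devLevel n p δ < 2 * η := by
  have hp0 : p ≠ 0 := by omega
  have hn' : (0 : ℝ) < n := by positivity
  have hp2 : (2 : ℝ) ≤ p := by exact_mod_cast hp
  have hε := devLevel_pos hn hp0 hδ hδ1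
  have hsq := mul_devLevel_sq hn hp0 hδ hδ1
  set ε := devLevel n p δ with hεdef
  set ℓ := Real.log (p / δ) with hℓ
  -- Here `2 ≤ p` enters, through `2 * p ^ 2 ≤ p ^ 3`.
  have hL : Real.log (2 * (p : ℝ) ^ 2 / δ) ≤ 3 * ℓ := by
    rw [hℓ, show (3 : ℝ) = ((3 : ℕ) : ℝ) by norm_num, ← Real.log_pow]
    refine Real.log_le_log (by positivity) ?_
    rw [div_pow]
    refine div_le_div₀ (by positivity) ?_ (by positivity) ?_
    · nlinarith [sq_nonneg (p : ℝ)]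
    · nlinarith [mul_pos hδ hδ, mul_pos (mul_pos hδ hδ) hδ]
  have hτ : truncThreshold n p β δ ≤ 4 * ε * Real.exp β := by
    rw [truncThreshold, div_le_iff₀ (Real.sqrt_pos.mpr (by linarith [Real.tanh_lt_one β]))]
    have h1 : Real.exp (-β) ≤ √(1 - Real.tanh β) := by
      refine Real.le_sqrt_of_sq_le ?_
      rw [← Real.exp_nat_mul]
      refine le_trans (le_of_eq ?_) (exp_neg_two_mul_le_one_sub_tanh hβ)
      congr 1
      push_cast
      ring
    have h2 : Real.exp β * Real.exp (-β) = 1 := by rw [← Real.exp_add, add_neg_cancel, Real.exp_zero]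
    have h3 := mul_le_mul_of_nonneg_left h1 (by positivity : 0 ≤ 4 * ε * Real.exp β)
    rw [mul_assoc, h2] at h3
    linarith
  have h1 : 1 ≤ Real.exp β := Real.one_le_exp hβ
  have h2 : Real.exp (2 * β) = Real.exp β ^ 2 := by rw [← Real.exp_nat_mul]; norm_num
  have h3 : 6 * ε * Real.exp β < 2 * η := by
    refine lt_of_pow_lt_pow_left₀ 2 (by positivity) ?_
    refine lt_of_mul_lt_mul_left ?_ hn'.le
    rw [h2] at h
    have h4 : n * (6 * ε * Real.exp β) ^ 2 = 36 * Real.exp β ^ 2 * (n * ε ^ 2) := by ring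
    have h5 : 0 ≤ ℓ := by
      refine Real.log_nonneg ((one_le_div hδ).mpr (by linarith))
    rw [h4, hsq]
    have h6 := mul_le_mul_of_nonneg_left hL (by positivity : 0 ≤ 72 * Real.exp β ^ 2)
    have h7 : 0 ≤ Real.exp β ^ 2 * ℓ := by positivity
    nlinarith
  nlinarith

end Constants

/-! ### Union bounds for the three bad events -/

section Events

set_option linter.unusedSectionVars false
variable {V : Type*} [Fintype V] [DecidableEq V] [Nonempty V] {n : ℕ}

theorem pi_real_exists_deviation_le (P : Measure (SpinConfig V)) [IsProbabilityMeasure P]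
    (hn : n ≠ 0) {δ : ℝ} (hδ : 0 < δ) (hδ1 : δ < 1) :
    (Measure.pi fun _ : Fin n => P).real
      (⋃ e : {e : Sym2 V // ¬e.IsDiag},
        {X | devLevel n (Fintype.card V) δ < |corr (empiricalDist X) e.1 - corr P e.1|}) ≤
          δ / 2 := by
  have hp : Fintype.card V ≠ 0 := Fintype.card_ne_zero
  have hp1 : (1 : ℝ) ≤ Fintype.card V := by exact_mod_cast Nat.one_le_iff_ne_zero.mpr hp
  have hbound : ∀ e : {e : Sym2 V // ¬e.IsDiag}, (Measure.pi fun _ : Fin n => P).real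
      {X | devLevel n (Fintype.card V) δ < |corr (empiricalDist X) e.1 - corr P e.1|} ≤
        2 * (δ / (2 * (Fintype.card V : ℝ) ^ 2)) := by
    intro e
    refine (pi_real_corr_deviation_le P hn e.1 (devLevel_pos hn hp hδ hδ1)).trans_eq ?_
    rw [mul_devLevel_sq hn hp hδ hδ1, mul_div_cancel_left₀ _ two_ne_zero,
      exp_neg_log_two_mul_sq_div hp hδ]
  have hcard : (Fintype.card {e : Sym2 V // ¬e.IsDiag} : ℝ) =
      (Fintype.card V : ℝ) * ((Fintype.card V : ℝ) - 1) / 2 := by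
    rw [Sym2.card_subtype_not_diag, Nat.cast_choose_two]
  refine (measureReal_iUnion_le_card_mul _ _ hbound).trans ?_
  rw [hcard]
  generalize (Fintype.card V : ℝ) = p at hp1
  rw [← sub_nonneg]
  have h : δ / 2 - p * (p - 1) / 2 * (2 * (δ / (2 * p ^ 2))) = δ / (2 * p) := by
    field_simp
    ring
  rw [h]
  positivity

/-- By the choice of `τ` the Chernoff exponent is at least `4 * n * ε ^ 2 = 8 * log (2 * p ^ 2 /
δ)`, enough for a union over `p ^ 4` quadruples of vertices. Quadruples violating the deterministic
conditions give the empty event. -/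
theorem pi_real_exists_strong_failure_le {T : SimpleGraph V} (hT : T.IsAcyclic)
    {m : Sym2 V → ℝ} (hm : ∀ e, |m e| ≤ 1) {β : ℝ} (hβ : ∀ e ∈ T.edgeSet, |m e| ≤ Real.tanh β)
    (P : Measure (SpinConfig V)) [IsProbabilityMeasure P]
    (hP : ∀ x, P.real {x} = forestDensity T m x) (hn : n ≠ 0) {δ : ℝ} (hδ : 0 < δ)
    (hδ1 : δ < 1) :
    (Measure.pi fun _ : Fin n => P).real
      (⋃ i : (V × V) × (V × V),
        {X | (s(i.1.1, i.1.2) ∈ T.edgeSet ∧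
            truncThreshold n (Fintype.card V) β δ ≤ |m s(i.1.1, i.1.2)| ∧
            ∃ p : T.Walk i.2.1 i.2.2, p.IsPath ∧ s(i.1.1, i.1.2) ∈ p.edges ∧
              s(i.2.1, i.2.2) ≠ s(i.1.1, i.1.2)) ∧
          |corr (empiricalDist X) s(i.1.1, i.1.2)| ≤
            |corr (empiricalDist X) s(i.2.1, i.2.2)|}) ≤ δ / 4 := by
  have hp : Fintype.card V ≠ 0 := Fintype.card_ne_zero
  have hbound : ∀ i : (V × V) × (V × V), (Measure.pi fun _ : Fin n => P).real
        {X | (s(i.1.1, i.1.2) ∈ T.edgeSet ∧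
            truncThreshold n (Fintype.card V) β δ ≤ |m s(i.1.1, i.1.2)| ∧
            ∃ p : T.Walk i.2.1 i.2.2, p.IsPath ∧ s(i.1.1, i.1.2) ∈ p.edges ∧
              s(i.2.1, i.2.2) ≠ s(i.1.1, i.1.2)) ∧
          |corr (empiricalDist X) s(i.1.1, i.1.2)| ≤
            |corr (empiricalDist X) s(i.2.1, i.2.2)|} ≤
        2 * (δ / (2 * (Fintype.card V : ℝ) ^ 2)) ^ 8 := by
    rintro ⟨⟨u, v⟩, a, b⟩
    by_cases hc : s(u, v) ∈ T.edgeSet ∧ truncThreshold n (Fintype.card V) β δ ≤ |m s(u, v)| ∧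
        ∃ p : T.Walk a b, p.IsPath ∧ s(u, v) ∈ p.edges ∧ s(a, b) ≠ s(u, v)
    · have hsub := hc
      obtain ⟨hf, hτ, p, hpath, hfp, hne⟩ := hc
      obtain ⟨g, hg, hgf⟩ := exists_mem_edges_ne hpath hfp hne
      have hU : ∀ e ∈ p.edges.toFinset.erase s(u, v), e ∈ T.edgeSet := fun e he =>
        p.edges_subset_edgeSet (List.mem_toFinset.mp (Finset.mem_of_mem_erase he))
      have hmain := pi_real_abs_corr_le_abs_corr hT m P hP hn (e := s(a, b)) hf hU
        (Finset.notMem_erase _ _) fun x => by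
          rw [Finset.mul_prod_erase _ _ (List.mem_toFinset.mpr hfp), prod_edgeSpin_path hpath]
      refine (measureReal_mono (fun X hX => hX.2)).trans (hmain.trans ?_)
      refine mul_le_mul_of_nonneg_left ?_ two_pos.le
      rw [← exp_neg_log_two_mul_sq_div hp hδ, ← Real.exp_nat_mul]
      refine Real.exp_le_exp.mpr ?_
      have hM : |∏ e ∈ p.edges.toFinset.erase s(u, v), m e| ≤ Real.tanh β :=
        (abs_prod_le_abs_of_mem (fun e _ => hm e)
          (Finset.mem_erase.mpr ⟨hgf, List.mem_toFinset.mpr hg⟩)).trans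
          (hβ g (p.edges_subset_edgeSet hg))
      have hn' : (0 : ℝ) < n := by positivity
      have h1 : 0 < 1 - Real.tanh β := by linarith [Real.tanh_lt_one β]
      have hε := devLevel_pos hn hp hδ hδ1
      have hτ0 : 0 ≤ truncThreshold n (Fintype.card V) β δ := by
        unfold truncThreshold; positivity
      have h2 : truncThreshold n (Fintype.card V) β δ ^ 2 ≤ m s(u, v) ^ 2 := by
        rw [← sq_abs (m s(u, v))]
        exact pow_le_pow_left₀ hτ0 hτ 2
      have h3 := mul_le_mul (sub_le_sub_left hM 1) h2 (sq_nonneg _) (by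
        linarith [hM.trans (Real.tanh_lt_one β).le] )
      rw [mul_comm, truncThreshold_sq_mul] at h3
      have h4 := mul_le_mul_of_nonneg_left h3 hn'.le
      have h5 := mul_devLevel_sq hn hp hδ hδ1
      push_cast
      linarith
    · have hempty : {X : Fin n → SpinConfig V | (s(u, v) ∈ T.edgeSet ∧
          truncThreshold n (Fintype.card V) β δ ≤ |m s(u, v)| ∧
          ∃ p : T.Walk a b, p.IsPath ∧ s(u, v) ∈ p.edges ∧ s(a, b) ≠ s(u, v)) ∧
          |corr (empiricalDist X) s(u, v)| ≤ |corr (empiricalDist X) s(a, b)|} = ∅ :=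
        Set.eq_empty_of_forall_notMem fun X hX => hc hX.1
      rw [hempty, measureReal_empty]
      positivity
  refine (measureReal_iUnion_le_card_mul _ _ hbound).trans ?_
  rw [Fintype.card_prod, Fintype.card_prod]
  push_cast
  have hp1 : (1 : ℝ) ≤ Fintype.card V := by exact_mod_cast Nat.one_le_iff_ne_zero.mpr hp
  generalize (Fintype.card V : ℝ) = p at hp1
  set q := δ / (2 * p ^ 2) with hq
  have hq0 : 0 < q := by positivity
  have hqp : q * p ^ 2 = δ / 2 := by rw [hq]; field_simp
  have hq1 : q ≤ 1 := by nlinarith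
  have h6 : q ^ 6 ≤ 1 := pow_le_one₀ hq0.le hq1
  have h : p * p * (p * p) * (2 * q ^ 8) = 2 * (q * p ^ 2) ^ 2 * q ^ 6 := by ring
  rw [h, hqp]
  have h7 : q ≤ 1 / 2 := by nlinarith
  have h8 : q ^ 6 ≤ 1 / 2 := (pow_le_of_le_one hq0.le hq1 (by norm_num)).trans h7
  nlinarith [mul_pos hδ hδ]

/-- Paths in a forest are unique, so the union runs over `p ^ 2` pairs of ends only. The constant
`64` makes the exponent `n * η ^ 2 / 4` exceed `16 * log (p / δ)`. -/
theorem pi_real_exists_prod_deviation_le {T : SimpleGraph V} (hT : T.IsAcyclic)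
    {m : Sym2 V → ℝ} (hm : ∀ e, |m e| ≤ 1) (P : Measure (SpinConfig V)) [IsProbabilityMeasure P]
    (hP : ∀ x, P.real {x} = forestDensity T m x) (hn : n ≠ 0) (hV : 2 ≤ Fintype.card V)
    {η δ : ℝ} (hη : 0 < η) (hη1 : η ≤ 1) (hδ : 0 < δ) (hδ1 : δ < 1)
    (h : 64 * Real.log (Fintype.card V / δ) < n * η ^ 2) :
    (Measure.pi fun _ : Fin n => P).real
      (⋃ i : V × V, {X | ∃ p : T.Walk i.1 i.2, p.IsPath ∧
        η < |∏ e ∈ p.edges.toFinset, corr (empiricalDist X) e - ∏ e ∈ p.edges.toFinset, m e|}) ≤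
          δ / 4 := by
  have hbound : ∀ i : V × V, (Measure.pi fun _ : Fin n => P).real
      {X | ∃ p : T.Walk i.1 i.2, p.IsPath ∧
        η < |∏ e ∈ p.edges.toFinset, corr (empiricalDist X) e - ∏ e ∈ p.edges.toFinset, m e|} ≤
      2 * (δ / Fintype.card V) ^ 16 := by
    rintro ⟨a, b⟩
    by_cases hab : T.Reachable a b
    · obtain ⟨p, hp⟩ := hab.exists_isPath
      have hmain := pi_real_prod_deviation_le hT hm P hP hn (S := p.edges.toFinset)
        (fun e he => p.edges_subset_edgeSet (List.mem_toFinset.mp he)) hη hη1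
      refine (measureReal_mono fun X hX => ?_).trans (hmain.trans ?_)
      · obtain ⟨q, hq, hX⟩ := hX
        have : q = p := congrArg Subtype.val ((hT.subsingleton_path a b).elim ⟨q, hq⟩ ⟨p, hp⟩)
        rwa [this] at hX
      · refine mul_le_mul_of_nonneg_left ?_ two_pos.le
        have hexp : δ / Fintype.card V = Real.exp (-Real.log (Fintype.card V / δ)) := by
          rw [Real.exp_neg, Real.exp_log (by positivity), inv_div]
        rw [hexp, ← Real.exp_nat_mul]
        refine Real.exp_le_exp.mpr ?_
        push_cast
        linarith
    · have hempty : {X : Fin n → SpinConfig V | ∃ p : T.Walk a b, p.IsPath ∧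
          η < |∏ e ∈ p.edges.toFinset, corr (empiricalDist X) e -
            ∏ e ∈ p.edges.toFinset, m e|} = ∅ :=
        Set.eq_empty_of_forall_notMem fun X ⟨p, _⟩ => hab p.reachable
      rw [hempty, measureReal_empty]
      positivity
  refine (measureReal_iUnion_le_card_mul _ _ hbound).trans ?_
  rw [Fintype.card_prod]
  push_cast
  have hp2 : (2 : ℝ) ≤ Fintype.card V := by exact_mod_cast hV
  generalize (Fintype.card V : ℝ) = p at hp2
  set q := δ / p with hq
  have hq0 : 0 < q := by positivity
  have hqp : q * p = δ := by rw [hq]; field_simp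
  have hq1 : q ≤ 1 / 2 := by nlinarith
  have h14 : q ^ 14 ≤ (1 / 2) ^ 14 := pow_le_pow_left₀ hq0.le hq1 14
  have h' : p * p * (2 * q ^ 16) = 2 * (q * p) ^ 2 * q ^ 14 := by ring
  rw [h', hqp]
  norm_num at h14
  nlinarith [mul_pos hδ hδ]

end Events

/-! ### Assembly of the events -/

theorem mainTheorem7 :
    ∃ C : ℝ, 0 < C ∧
      ∀ (p n : ℕ) (T : SimpleGraph (Fin p)) (θ : Sym2 (Fin p) → ℝ) (β η δ : ℝ),
        T.IsTree → 0 ≤ β → (∀ e ∈ T.edgeSet, |θ e| ≤ β) → 0 < η → 0 < δ → δ < 1 →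
        C * max (Real.exp (2 * β) / η ^ 2 * Real.log (p / δ))
            (1 / η ^ 2 * Real.log (p / (η * δ))) < n →
        1 - δ ≤ (Measure.pi fun _ : Fin n => isingMeasure T θ).real
          {X : Fin n → SpinConfig (Fin p) |
            (∃ F : SimpleGraph (Fin p),
              IsTruncationOutput X (truncThreshold n p β δ + devLevel n p δ) F) ∧
            ∀ F : SimpleGraph (Fin p),
              IsTruncationOutput X (truncThreshold n p β δ + devLevel n p δ) F →
              F.IsAcyclic ∧
              F.edgeSet ⊆ T.edgeSet ∧
              (∀ e ∈ T.edgeSet,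
                truncThreshold n p β δ + 2 * devLevel n p δ ≤ |corr (isingMeasure T θ) e| →
                e ∈ F.edgeSet) ∧
              ∃ R : Measure (SpinConfig (Fin p)),
                IsIsingProjection F (empiricalDist X) R ∧
                (∀ R' : Measure (SpinConfig (Fin p)),
                  IsIsingProjection F (empiricalDist X) R' → R' = R) ∧
                (∀ e ∈ F.edgeSet, corr R e = corr (empiricalDist X) e) ∧
                smallSetTV 2 (isingMeasure T θ) R < η} := by
  refine ⟨64, by norm_num, fun p n T θ β η δ hT hβ hθ hη hδ hδ1 hC => ?_⟩
  have := hT.connected.nonempty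
  have hp : p ≠ 0 := by
    rintro rfl
    exact this.elim fun x => x.elim0
  have hp1 : (1 : ℝ) ≤ p := by exact_mod_cast Nat.one_le_iff_ne_zero.mpr hp
  have hlog : 0 < Real.log (p / δ) := Real.log_pos ((one_lt_div hδ).mpr (by linarith))
  have hsample : 64 * Real.exp (2 * β) * Real.log (p / δ) < n * η ^ 2 := by
    have h := (mul_le_mul_of_nonneg_left (le_max_left _ _) (by norm_num)).trans_lt hC
    have h2 := mul_lt_mul_of_pos_right h (pow_pos hη 2)
    refine lt_of_eq_of_lt ?_ h2
    field_simp
  have hn : n ≠ 0 := by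
    rintro rfl
    have : 0 < 64 * Real.exp (2 * β) * Real.log (p / δ) := by positivity
    simp at hsample
    linarith
  have hsample' : 64 * Real.log (p / δ) < n * η ^ 2 := by
    have := mul_le_mul_of_nonneg_right (Real.one_le_exp (by linarith : 0 ≤ 2 * β)) hlog.le
    linarith
  have hcard : Fintype.card (Fin p) = p := Fintype.card_fin p
  have hA := hT.isAcyclic
  have hPprob := isProbabilityMeasure_isingMeasure hA θ
  have hP := isingMeasure_real_singleton hA θ
  set P := isingMeasure T θ with hPdef
  set m : Sym2 (Fin p) → ℝ := fun e => Real.tanh (θ e) with hmdef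
  have hm : ∀ e, |m e| ≤ 1 := fun e => (abs_tanh_lt_one _).le
  have hmβ : ∀ e ∈ T.edgeSet, |m e| ≤ Real.tanh β := fun e he => abs_tanh_le_tanh (hθ e he)
  have hE1 := pi_real_exists_deviation_le P hn hδ hδ1
  have hE2 := pi_real_exists_strong_failure_le hA hm hmβ P hP hn hδ hδ1
  rw [hcard] at hE1 hE2
  -- For `p = 1` there is no pair to control and for `η > 1` the loss bound is trivial, so the empty
  -- event serves there.
  have hE3 : ∃ E : Set (Fin n → SpinConfig (Fin p)),
      (Measure.pi fun _ : Fin n => P).real E ≤ δ / 4 ∧ ∀ X, X ∉ E → 2 ≤ p → η ≤ 1 →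
        ∀ (a b : Fin p) (q : T.Walk a b), q.IsPath →
          |∏ e ∈ q.edges.toFinset, corr (empiricalDist X) e - ∏ e ∈ q.edges.toFinset, m e| ≤ η := by
    by_cases hc : 2 ≤ p ∧ η ≤ 1
    · refine ⟨_, pi_real_exists_prod_deviation_le hA hm P hP hn (by rw [hcard]; exact hc.1) hη
        hc.2 hδ hδ1 (by rw [hcard]; exact hsample'), fun X hX _ _ a b q hq => ?_⟩
      by_contra hlt
      exact hX (Set.mem_iUnion.mpr ⟨(a, b), q, hq, not_le.mp hlt⟩)
    · refine ⟨∅, by rw [measureReal_empty]; positivity, fun X _ h1 h2 => absurd ⟨h1, h2⟩ hc⟩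
  obtain ⟨E3, hE3, hE3'⟩ := hE3
  set E1 := ⋃ e : {e : Sym2 (Fin p) // ¬e.IsDiag}, _ with hE1def
  set E2 := ⋃ i : (Fin p × Fin p) × (Fin p × Fin p), _ with hE2def
  have hunion : (Measure.pi fun _ : Fin n => P).real (E1 ∪ E2 ∪ E3) ≤ δ := by
    refine (measureReal_union_le _ _).trans ?_
    linarith [measureReal_union_le (μ := Measure.pi fun _ : Fin n => P) E1 E2]
  have hcompl := probReal_compl_eq_one_sub (μ := Measure.pi fun _ : Fin n => P)
    (s := E1 ∪ E2 ∪ E3) (Set.toFinite _).measurableSet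
  refine (by linarith : 1 - δ ≤ (Measure.pi fun _ : Fin n => P).real (E1 ∪ E2 ∪ E3)ᶜ).trans
    (measureReal_mono fun X hX => ?_)
  simp only [Set.mem_compl_iff, Set.mem_union, not_or] at hX
  obtain ⟨⟨hX1, hX2⟩, hX3⟩ := hX
  have hdev : ∀ e : Sym2 (Fin p), ¬e.IsDiag →
      |corr (empiricalDist X) e - corr P e| ≤ devLevel n p δ := by
    intro e he
    by_contra hlt
    exact hX1 (Set.mem_iUnion.mpr ⟨⟨e, he⟩, not_le.mp hlt⟩)
  have hstrong : ∀ f ∈ T.edgeSet, truncThreshold n p β δ ≤ |m f| →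
      ∀ (a b : Fin p) (q : T.Walk a b), q.IsPath → f ∈ q.edges → s(a, b) ≠ f →
        |corr (empiricalDist X) s(a, b)| < |corr (empiricalDist X) f| := by
    intro f hf hτ a b q hq hfq hne
    by_contra hlt
    induction f with
    | h u v =>
      exact hX2 (Set.mem_iUnion.mpr ⟨((u, v), (a, b)), ⟨hf, hτ, q, hq, hfq, hne⟩, not_lt.mp hlt⟩)
  refine ⟨exists_isTruncationOutput X _, fun F hF => ?_⟩
  obtain ⟨hFA, hFT, hFstrong⟩ := hF.isAcyclic_and_subset_and_superset hT hm hP (devLevel_pos hn hp hδ hδ1).le hdev hstrong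
  have hQ := isProbabilityMeasure_empiricalDist hn X
  have hc := abs_corr_le_one (empiricalDist X)
  obtain ⟨hproj, huniq⟩ := isIsingProjection_densityMeasure hFA (empiricalDist X)
  have hR := densityMeasure_real_singleton (forestDensity_nonneg (G := F) fun e _ => hc e)
  have hRprob := hproj.1.1
  refine ⟨hFA, hFT, hFstrong, _, hproj, huniq,
    fun e he => corr_eq_of_real_singleton hFA hR he, ?_⟩
  refine smallSetTV_two_lt P _ (fun a => ?_) (fun a => ?_) hη fun a b hab => ?_
  · simp_rw [hP]
    exact sum_forestDensity_mul_spinVal T m a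
  · simp_rw [hR]
    exact sum_forestDensity_mul_spinVal F _ a
  · have hp2 : 2 ≤ p := by
      have := Fin.val_ne_of_ne hab
      omega
    by_cases hη1 : η ≤ 1
    · refine abs_corr_sub_corr_lt hT hm hP hR hFT hη (fun e he heF => ?_)
        (hE3' X hX3 hp2 hη1) a b
      by_contra hlt
      refine heF (hFstrong e he ?_)
      rw [corr_eq_of_real_singleton hA hP he]
      exact (truncThreshold_add_lt hn hp2 hβ hη hδ hδ1 hsample).le.trans (not_lt.mp hlt)
    -- Two correlations differ by at most `2`, which is below `2 * η` here.
    · have h1 := abs_le.mp (abs_corr_le_one P s(a, b))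
      have h2 := abs_le.mp (abs_corr_le_one
        (densityMeasure (forestDensity F (corr (empiricalDist X)))) s(a, b))
      rw [abs_lt]
      constructor <;> linarith [not_le.mp hη1]
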